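/- Let $n\ge 1$, let $x=(x_1,\dots,x_n)$ denote a point of $\mathbb{R}^n$ with vertical coordinate $x_n$, and fix a source point $y\in\mathbb{R}^n$. A family $(U_E)_{E\in\mathbb{R}}$ of tempered distributions on $\mathbb{R}^n$ is called a causal fundamental solution of the gravity Helmholtz equation $(\Delta+E+x_n)u=0$ with source point $y$ if (i) $-(\Delta+E+x_n)U_E=\delta_y$ in $\mathcal{S}'(\mathbb{R}^n)$ for every $E\in\mathbb{R}$; (ii) for every $\varphi\in\mathcal{S}(\mathbb{R}^n)$ the function $E\mapsto\langle U_E,\varphi\rangle$ is continuous and of at most polynomial growth, and its transform from energy to time, $\frac1{2\pi}\int_{-\infty}^{\infty}\langle U_E,\varphi\rangle e^{-iEt}\,dE$ (a tempered distribution in $t$), vanishes for $t<0$. Then there is exactly one causal fundamental solution with source point $y$, and for every $E\in\mathbb{R}$ the distribution $U_E$ is the locally integrable function $\Phi(\cdot,y)$, continuous on $\mathbb{R}^n\setminus\{y\}$, given by $$\Phi(x,y)=\frac{i}{(4\pi i)^{n/2}}\int_0^\infty t^{-n/2}\exp i\left[\frac{|x-y|^2}{4t}+\left(\frac{x_n+y_n}{2}+E\right)t-\frac{t^3}{12}\right]dt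 ,$$ with the principal branch of $(4\pi i)^{n/2}$. Here, for every $x\ne y$ (and also for $x=y$ if $n=1$), the integral converges as an oscillatory integral: with the additional factor $e^{-a/t-bt}$ in the integrand it converges absolutely for all $a,b>0$, and it denotes the limit as $(a,b)\to(0^+,0^+)$. For $n\le 3$ it moreover converges, to the same value, as an improper integral $\lim_{\alpha\to0^+,\ \beta\to\infty}\int_\alpha^\beta$. -/

import Mathlib

open Filter Topology MeasureTheory SchwartzMap

noncomputable section

namespace GravityHelmholtz

/-! ### Oscillatory integrals over the half-line -/

/-- The integrand `f`, damped at both ends of `(0, ∞)`: `exp (-a / t - b t) f t`. -/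
def damped (f : ℝ → ℂ) (a b t : ℝ) : ℂ :=
  (Real.exp (-a / t - b * t) : ℂ) * f t

/-- The oscillatory integral `∫₀^∞ f t dt` exists and has the value `J`: the damped integrals
`∫₀^∞ exp (-a / t - b t) f t dt` converge absolutely for all `a, b > 0`, and tend to `J`
as `a` and `b` decrease to `0` (independently of each other). -/
def HasOscillatoryIntegral (f : ℝ → ℂ) (J : ℂ) : Prop :=
  (∀ a b : ℝ, 0 < a → 0 < b → IntegrableOn (damped f a b) (Set.Ioi 0)) ∧
    Tendsto (fun p : ℝ × ℝ => ∫ t in Set.Ioi (0 : ℝ), damped f p.1 p.2 t)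
      (𝓝[>] 0 ×ˢ 𝓝[>] 0) (𝓝 J)

/-- The improper Riemann integral `∫₀^∞ f t dt` converges (possibly only conditionally) to `J`. -/
def HasImproperIntegral (f : ℝ → ℂ) (J : ℂ) : Prop :=
  (∀ a b : ℝ, 0 < a → a ≤ b → IntervalIntegrable f volume a b) ∧
    Tendsto (fun p : ℝ × ℝ => ∫ t in p.1..p.2, f t) (𝓝[>] 0 ×ˢ atTop) (𝓝 J)

/-- The value of the oscillatory integral of `f` (meaningful when it exists). -/
def oscillatoryIntegral (f : ℝ → ℂ) : ℂ :=
  limUnder (𝓝[>] (0 : ℝ) ×ˢ 𝓝[>] (0 : ℝ))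
    (fun p : ℝ × ℝ => ∫ t in Set.Ioi (0 : ℝ), damped f p.1 p.2 t)

theorem HasOscillatoryIntegral.eq {f : ℝ → ℂ} {J : ℂ} (h : HasOscillatoryIntegral f J) :
    oscillatoryIntegral f = J :=
  h.2.limUnder_eq

/-! ### The explicit kernel -/

/-- The vertical coordinate `xₙ` of `x = (x₁, …, xₙ)`. -/
def vert {n : ℕ} [NeZero n] (x : EuclideanSpace ℝ (Fin n)) : ℝ :=
  x ⟨n - 1, Nat.sub_one_lt (NeZero.ne n)⟩

/-- The phase `|x - y|² / (4 t) + ((xₙ + yₙ) / 2 + E) t - t³ / 12`. -/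
def phase {n : ℕ} [NeZero n] (E : ℝ) (x y : EuclideanSpace ℝ (Fin n)) (t : ℝ) : ℝ :=
  ‖x - y‖ ^ 2 / (4 * t) + ((vert x + vert y) / 2 + E) * t - t ^ 3 / 12

/-- The integrand `t ^ (-n / 2) exp (i phase)`, for `t > 0`. -/
def kernelIntegrand {n : ℕ} [NeZero n] (E : ℝ) (x y : EuclideanSpace ℝ (Fin n)) (t : ℝ) : ℂ :=
  ((t ^ (-((n : ℝ) / 2)) : ℝ) : ℂ) * Complex.exp (Complex.I * (phase E x y t : ℂ))

/-- `Φ(x, y) = i (4 π i) ^ (-n / 2) ∫₀^∞ t ^ (-n / 2) exp (i phase) dt` at energy `E`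
(principal branch of the power). -/
def kernel {n : ℕ} [NeZero n] (E : ℝ) (x y : EuclideanSpace ℝ (Fin n)) : ℂ :=
  Complex.I / (4 * (Real.pi : ℂ) * Complex.I) ^ ((n : ℂ) / 2) *
    oscillatoryIntegral (kernelIntegrand E x y)

/-! ### Causal fundamental solutions -/

theorem potential_hasTemperateGrowth {n : ℕ} [NeZero n] (E : ℝ) :
    Function.HasTemperateGrowth
      (fun x : EuclideanSpace ℝ (Fin n) => ((E + vert x : ℝ) : ℂ)) := by
  have h1 : Function.HasTemperateGrowth (fun x : EuclideanSpace ℝ (Fin n) => vert x) :=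
    (EuclideanSpace.proj (𝕜 := ℝ)
      (⟨n - 1, Nat.sub_one_lt (NeZero.ne n)⟩ : Fin n)).hasTemperateGrowth
  exact Complex.ofRealCLM.hasTemperateGrowth.comp
    ((Function.HasTemperateGrowth.const E).add h1)

/-- The gravity Helmholtz operator `Δ + E + xₙ` on tempered distributions. -/
def gravityOp {n : ℕ} [NeZero n] (E : ℝ) (T : 𝓢'(EuclideanSpace ℝ (Fin n), ℂ)) :
    𝓢'(EuclideanSpace ℝ (Fin n), ℂ) :=
  Laplacian.laplacian T +
    TemperedDistribution.smulLeftCLM ℂ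
      (fun x : EuclideanSpace ℝ (Fin n) => ((E + vert x : ℝ) : ℂ)) T

theorem gravityOp_apply {n : ℕ} [NeZero n] (E : ℝ) (T : 𝓢'(EuclideanSpace ℝ (Fin n), ℂ))
    (φ : 𝓢(EuclideanSpace ℝ (Fin n), ℂ)) :
    gravityOp E T φ = T (Laplacian.laplacian φ +
      SchwartzMap.smulLeftCLM ℂ
        (fun x : EuclideanSpace ℝ (Fin n) => ((E + vert x : ℝ) : ℂ)) φ) := by
  simp [gravityOp, map_add]

/-- The energy-to-time transform `(1 / 2π) ∫ f(E) e^{-iEt} dE` of a function `f` of the energy,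
as a tempered distribution in the time `t`, evaluated at the test function `χ`. -/
def timeTransform (f : ℝ → ℂ) (χ : 𝓢(ℝ, ℂ)) : ℂ :=
  1 / (2 * (Real.pi : ℂ)) *
    ∫ E : ℝ, f E * ∫ t : ℝ, χ t * Complex.exp (-(Complex.I * (E : ℂ) * (t : ℂ)))

/-- A family `U E` (`E` real) of tempered distributions on `ℝⁿ` is a causal fundamental solution
of the gravity Helmholtz equation with source point `y`: it solves `-(Δ + E + xₙ) U E = δ_y` for
every energy `E`, it depends weakly continuously on `E` with at most polynomial growth (so that
its transform from energy to time is defined), and this transform vanishes for times `t < 0`. -/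
structure IsCausalFundamentalSolution {n : ℕ} [NeZero n] (y : EuclideanSpace ℝ (Fin n))
    (U : ℝ → 𝓢'(EuclideanSpace ℝ (Fin n), ℂ)) : Prop where
  fundamental : ∀ E : ℝ, -gravityOp E (U E) = TemperedDistribution.delta y
  continuous_energy : ∀ φ : 𝓢(EuclideanSpace ℝ (Fin n), ℂ), Continuous (fun E : ℝ => U E φ)
  growth_energy : ∀ φ : 𝓢(EuclideanSpace ℝ (Fin n), ℂ),
    ∃ (C : ℝ) (N : ℕ), ∀ E : ℝ, ‖U E φ‖ ≤ C * (1 + |E|) ^ N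
  causal : ∀ (φ : 𝓢(EuclideanSpace ℝ (Fin n), ℂ)) (χ : 𝓢(ℝ, ℂ)),
    tsupport χ ⊆ Set.Iio 0 → timeTransform (fun E => U E φ) χ = 0

/-- The tempered distribution `T` is (integration against) the locally integrable function `g`. -/
def IsRegularWith {n : ℕ} (T : 𝓢'(EuclideanSpace ℝ (Fin n), ℂ))
    (g : EuclideanSpace ℝ (Fin n) → ℂ) : Prop :=
  LocallyIntegrable g ∧
    ∀ φ : 𝓢(EuclideanSpace ℝ (Fin n), ℂ), HasCompactSupport φ → T φ = ∫ x, g x * φ x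

end GravityHelmholtz

end

noncomputable section

namespace GravityHelmholtz

/-! ### Rotation of the contour -/

/-! The causal solution is the outgoing resolvent of the Stark operator H = Δ + xₙ: U_E φ = i ∫₀^∞
e^{iEt} (e^{itH} φ)(y) dt. The evolution is explicit (Avron–Herbst): (e^{itH} φ)(y) = e^{i(t yₙ -
t³/3)} (e^{itΔ} φ)(y - t² e), with e the upward unit vector. In momentum space this is an
oscillatory integral, `propagator`. The field displaces by t², and two integrations by parts in the
direction e yield decay like 1/t² in every dimension (`norm_propagator_le`), so the time integral
converges absolutely. The fundamental theorem of calculus in t gives the equation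
(`causalPairing_stark`), and Fubini with Fourier inversion gives causality.

For the kernel formula, substitute t = e^w. The integrand becomes entire in w, and on the line Im w
= -π/6 the factor e^{-it³/12} turns into e^{-|t|³/12}, while e^{i|x-y|²/(4t)} decays as t → 0.
Cauchy's theorem replaces the oscillatory integral by `rotatedIntegral`, which is absolutely
convergent and continuous in its coefficients up to the undamped boundary. A Gaussian regularisation
computes the propagator in position space. Damping by e^{-ε/t-εt} then permits Fubini, and ε → 0
identifies U_E with Φ (`causalPairing_eq_integral_kernel`), dominated by the rotated contour's
bound.

For uniqueness, the difference W_E of two solutions satisfies W_E(Hφ) = -E W_E φ. A cubic phase in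
momentum space conjugates H to multiplication by xₙ, so e^{-isH} acts on Schwartz functions and
W_E(e^{-isH} φ) = e^{isE} W_E φ (`apply_starkShift`). Replacing φ by e^{-isH} φ therefore translates
the time transform. As all these translates vanish for t < 0, the transform vanishes on every
compactly supported test function, and W_E = 0 by continuity in E. -/

theorem exists_mul_le_add_mul_exp (d : ℝ) {b : ℝ} (hb : 0 < b) :
    ∃ K : ℝ, ∀ u : ℝ, 0 ≤ u → d * u ≤ K + b * Real.exp u := by
  refine ⟨d ^ 2 / (2 * b), fun u hu => ?_⟩
  have h1 := Real.quadratic_le_exp_of_nonneg hu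
  have h2 : d * u ≤ d ^ 2 / (2 * b) + b * (u ^ 2 / 2) := by
    have : d ^ 2 / (2 * b) + b * (u ^ 2 / 2) - d * u = (d - b * u) ^ 2 / (2 * b) := by
      field_simp
      ring
    have h3 : 0 ≤ (d - b * u) ^ 2 / (2 * b) := by positivity
    linarith
  have h3 : b * (u ^ 2 / 2) ≤ b * Real.exp u :=
    mul_le_mul_of_nonneg_left (by linarith) hb.le
  linarith

/-- At +∞ the double exponential b e^u beats any linear term. At -∞ either p e^{-u} does the same or
e^{mu} already decays. The case p = 0 covers x = y in dimension one and the radial integral left by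
Tonelli in `integrable_majorant`. -/
theorem integrable_exp_two_sided {m p b : ℝ} (hb : 0 < b) (hp : 0 ≤ p) (h : 0 < p ∨ 0 < m) :
    Integrable fun u : ℝ => Real.exp (m * u - p * Real.exp (-u) - b * Real.exp u) := by
  have hcont : Continuous fun u : ℝ =>
      Real.exp (m * u - p * Real.exp (-u) - b * Real.exp u) := by fun_prop
  rw [← integrableOn_univ, ← Set.Iic_union_Ioi (a := (0 : ℝ)), integrableOn_union]
  constructor
  · obtain ⟨κ, K, hκ, hK⟩ : ∃ κ K : ℝ, 0 < κ ∧ ∀ u ≤ (0 : ℝ),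
        m * u - p * Real.exp (-u) ≤ K + κ * u := by
      rcases h with h | h
      · obtain ⟨K, hK⟩ := exists_mul_le_add_mul_exp (1 - m) h
        refine ⟨1, K, one_pos, fun u hu => ?_⟩
        have := hK (-u) (by linarith)
        linarith
      · refine ⟨m, 0, h, fun u _ => ?_⟩
        have : 0 ≤ p * Real.exp (-u) := by positivity
        linarith
    refine Integrable.mono' ((integrableOn_exp_mul_Iic hκ 0).const_mul (Real.exp K))
      hcont.aestronglyMeasurable ?_
    filter_upwards [ae_restrict_mem measurableSet_Iic] with u hu
    rw [Real.norm_eq_abs, Real.abs_exp, ← Real.exp_add]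
    have h1 := hK u hu
    have h2 : 0 ≤ b * Real.exp u := by positivity
    exact Real.exp_le_exp.2 (by linarith)
  · obtain ⟨K, hK⟩ := exists_mul_le_add_mul_exp (m + 1) hb
    refine Integrable.mono' ((exp_neg_integrableOn_Ioi 0 one_pos).const_mul (Real.exp K))
      hcont.aestronglyMeasurable ?_
    filter_upwards [ae_restrict_mem measurableSet_Ioi] with u hu
    rw [Real.norm_eq_abs, Real.abs_exp, ← Real.exp_add]
    have h1 := hK u (le_of_lt hu)
    have h2 : 0 ≤ p * Real.exp (-u) := by positivity
    exact Real.exp_le_exp.2 (by linarith)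

/-- In logarithmic coordinates `t = exp w`, the integrand `t ^ (m - 1) exp (A / t + B t - i t³ / 12)`
becomes this entire function of `w`. -/
def airyExp (m : ℝ) (A B w : ℂ) : ℂ :=
  Complex.exp (m * w + A * Complex.exp (-w) + B * Complex.exp w
    - Complex.I / 12 * Complex.exp (3 * w))

/-- The integral of `airyExp` over the rotated contour `arg t = -π / 6`. -/
def rotatedIntegral (m : ℝ) (A B : ℂ) : ℂ :=
  ∫ u : ℝ, airyExp m A B (u - (Real.pi / 6 : ℝ) * Complex.I)

theorem differentiable_airyExp (m : ℝ) (A B : ℂ) : Differentiable ℂ (airyExp m A B) := by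
  unfold airyExp
  fun_prop

@[fun_prop]
theorem continuous_airyExp (m : ℝ) (A B : ℂ) : Continuous (airyExp m A B) :=
  (differentiable_airyExp m A B).continuous

/-- On the ray arg t = -θ the cubic term contributes -e^{3u} sin(3θ)/12 to the real exponent. This
fixes the direction of rotation, and θ = π/6 makes the decay maximal. -/
theorem norm_airyExp (m : ℝ) (A B : ℂ) (u θ : ℝ) :
    ‖airyExp m A B (u - θ * Complex.I)‖ =
      Real.exp (m * u + Real.exp (-u) * (A.re * Real.cos θ - A.im * Real.sin θ)
        + Real.exp u * (B.re * Real.cos θ + B.im * Real.sin θ)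
        - Real.exp (3 * u) * Real.sin (3 * θ) / 12) := by
  have e1 : Complex.exp (-((u : ℂ) - θ * Complex.I)) =
      Real.exp (-u) * (Real.cos θ + Real.sin θ * Complex.I) := by
    rw [show -((u : ℂ) - θ * Complex.I) = ((-u : ℝ) : ℂ) + θ * Complex.I by push_cast; ring,
      Complex.exp_add, Complex.exp_mul_I]
    push_cast; rfl
  have e2 : Complex.exp ((u : ℂ) - θ * Complex.I) =
      Real.exp u * (Real.cos θ - Real.sin θ * Complex.I) := by
    rw [show ((u : ℂ) - θ * Complex.I) = (u : ℂ) + ((-θ : ℝ) : ℂ) * Complex.I by push_cast; ring,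
      Complex.exp_add, Complex.exp_mul_I]
    push_cast; simp [sub_eq_add_neg]
  have e3 : Complex.exp (3 * ((u : ℂ) - θ * Complex.I)) =
      Real.exp (3 * u) * (Real.cos (3 * θ) - Real.sin (3 * θ) * Complex.I) := by
    rw [show 3 * ((u : ℂ) - θ * Complex.I) = ((3 * u : ℝ) : ℂ) + ((-(3 * θ) : ℝ) : ℂ) * Complex.I by
        push_cast; ring,
      Complex.exp_add, Complex.exp_mul_I]
    push_cast; simp [sub_eq_add_neg]
  rw [airyExp, e1, e2, e3, Complex.norm_exp]
  congr 1
  simp only [Complex.add_re, Complex.sub_re, Complex.mul_re, Complex.mul_im, Complex.add_im,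
    Complex.sub_im, Complex.ofReal_re, Complex.ofReal_im, Complex.I_re, Complex.I_im,
    Complex.div_ofNat_re, Complex.div_ofNat_im]
  ring

theorem exp_three_mul (u : ℝ) : Real.exp (3 * u) = Real.exp u ^ 3 := by
  rw [← Real.exp_nat_mul]; norm_num

/-- The cubic term dominates the linear one. -/
theorem linear_sub_cube_le {C v : ℝ} (hC : 0 ≤ C) (hv : 0 ≤ v) :
    C / 2 * v - v ^ 3 / 12 ≤ (C + 2) ^ 3 - v := by
  -- With c = C + 2 this reads v³ ≥ 3c²v - 2c³, the tangent line of the cube at c. The remaining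
  -- slope condition c/2 ≤ c²/4 holds because c ≥ 2.
  have h1 : 0 ≤ (v - (C + 2)) ^ 2 * (v + 2 * (C + 2)) := by positivity
  have h2 : 0 ≤ (C + 2) ^ 3 := by positivity
  have h3 : 0 ≤ C * (C + 2) * v := by positivity
  nlinarith [h1, h2, h3]

/-- The bound sees the coefficients only through q and C, so it dominates the integrand uniformly as
the damping is removed. -/
theorem norm_airyExp_rotated_le {m q C : ℝ} {A B : ℂ} (hA : A.re ≤ 0) (hq : q ≤ A.im)
    (hB : B.re ≤ 0) (hC : |B.im| ≤ C) (u : ℝ) :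
    ‖airyExp m A B (u - (Real.pi / 6 : ℝ) * Complex.I)‖ ≤
      Real.exp ((C + 2) ^ 3) *
        Real.exp (m * u - q / 2 * Real.exp (-u) - 1 * Real.exp u) := by
  rw [norm_airyExp, Real.cos_pi_div_six, Real.sin_pi_div_six,
    show 3 * (Real.pi / 6) = Real.pi / 2 by ring, Real.sin_pi_div_two, ← Real.exp_add]
  apply Real.exp_le_exp.2
  have hC0 : 0 ≤ C := (abs_nonneg _).trans hC
  have h1 := linear_sub_cube_le hC0 (Real.exp_pos u).le
  have h2 : Real.exp (-u) * (A.re * (√3 / 2) - A.im * (1 / 2)) ≤ Real.exp (-u) * (-(q / 2)) := by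
    apply mul_le_mul_of_nonneg_left _ (Real.exp_pos _).le
    have : A.re * (√3 / 2) ≤ 0 := mul_nonpos_of_nonpos_of_nonneg hA (by positivity)
    linarith
  have h3 : Real.exp u * (B.re * (√3 / 2) + B.im * (1 / 2)) ≤ Real.exp u * (C / 2) := by
    apply mul_le_mul_of_nonneg_left _ (Real.exp_pos _).le
    have : B.re * (√3 / 2) ≤ 0 := mul_nonpos_of_nonpos_of_nonneg hB (by positivity)
    have := (le_abs_self _).trans hC
    linarith
  rw [exp_three_mul]
  linarith

theorem integrable_airyExp_rotated {m : ℝ} {A B : ℂ} (hA : A.re ≤ 0) (hA' : 0 ≤ A.im)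
    (hB : B.re ≤ 0) (h : 0 < A.im ∨ 0 < m) :
    Integrable fun u : ℝ => airyExp m A B (u - (Real.pi / 6 : ℝ) * Complex.I) := by
  refine Integrable.mono' ((integrable_exp_two_sided (m := m) (p := A.im / 2) one_pos
    (by linarith) (h.imp_left fun h => by linarith)).const_mul (Real.exp ((|B.im| + 2) ^ 3)))
    (Continuous.aestronglyMeasurable (by fun_prop)) (ae_of_all _ fun u => ?_)
  exact norm_airyExp_rotated_le hA le_rfl hB le_rfl u

theorem norm_rotatedIntegral_le {m q C : ℝ} {A B : ℂ} (hA : A.re ≤ 0) (hq : q ≤ A.im)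
    (hB : B.re ≤ 0) (hC : |B.im| ≤ C) (hq0 : 0 ≤ q) (h : 0 < q ∨ 0 < m) :
    ‖rotatedIntegral m A B‖ ≤ Real.exp ((C + 2) ^ 3) *
      ∫ u : ℝ, Real.exp (m * u - q / 2 * Real.exp (-u) - 1 * Real.exp u) := by
  rw [← integral_const_mul]
  refine norm_integral_le_of_norm_le ((integrable_exp_two_sided one_pos (by linarith)
    (h.imp_left fun h => by linarith)).const_mul _) (ae_of_all _ fun u => ?_)
  exact norm_airyExp_rotated_le hA hq hB hC u

/-- Dominated convergence on the rotated contour. The set is closed and contains the undamped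
coefficients, with Re A = Re B = 0; this is what lets a and b tend to 0 independently. -/
theorem continuousWithinAt_rotatedIntegral {m : ℝ} {A₀ B₀ : ℂ} (h : 0 < A₀.im ∨ 0 < m) :
    ContinuousWithinAt (fun z : ℂ × ℂ => rotatedIntegral m z.1 z.2)
      {z | z.1.re ≤ 0 ∧ 0 ≤ z.1.im ∧ z.2.re ≤ 0} (A₀, B₀) := by
  obtain ⟨q, hq0, hq, hqm⟩ : ∃ q : ℝ, 0 ≤ q ∧ (0 < q ∨ 0 < m) ∧
      ∀ᶠ z : ℂ × ℂ in 𝓝[{z | z.1.re ≤ 0 ∧ 0 ≤ z.1.im ∧ z.2.re ≤ 0}] (A₀, B₀), q ≤ z.1.im := by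
    rcases h with h | h
    · refine ⟨A₀.im / 2, by linarith, Or.inl (by linarith), ?_⟩
      have hc : Continuous fun z : ℂ × ℂ => z.1.im := Complex.continuous_im.comp continuous_fst
      exact nhdsWithin_le_nhds
        ((hc.tendsto (A₀, B₀)).eventually (eventually_ge_nhds (show A₀.im / 2 < A₀.im by linarith)))
    · exact ⟨0, le_rfl, Or.inr h, by filter_upwards [self_mem_nhdsWithin] with z hz using hz.2.1⟩
  have hB : ∀ᶠ z : ℂ × ℂ in 𝓝[{z | z.1.re ≤ 0 ∧ 0 ≤ z.1.im ∧ z.2.re ≤ 0}] (A₀, B₀),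
      |z.2.im| ≤ |B₀.im| + 1 := by
    have hc : Continuous fun z : ℂ × ℂ => |z.2.im| :=
      (Complex.continuous_im.comp continuous_snd).abs
    exact nhdsWithin_le_nhds ((hc.tendsto (A₀, B₀)).eventually (eventually_le_nhds (by simp)))
  refine continuousWithinAt_of_dominated
    (bound := fun u => Real.exp ((|B₀.im| + 1 + 2) ^ 3) *
      Real.exp (m * u - q / 2 * Real.exp (-u) - 1 * Real.exp u))
    (Eventually.of_forall fun z => Continuous.aestronglyMeasurable (by fun_prop)) ?_
    ((integrable_exp_two_sided one_pos (by linarith)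
      (hq.imp_left fun h => by linarith)).const_mul _) (ae_of_all _ fun u => ?_)
  · filter_upwards [hqm, hB, self_mem_nhdsWithin] with z h1 h2 h3
    exact ae_of_all _ fun u => norm_airyExp_rotated_le h3.1 h1 h3.2.2 h2 u
  · apply Continuous.continuousWithinAt
    unfold airyExp
    fun_prop

/-- The integral over the arc `arg t ∈ [-π / 6, 0]`, `|t| = exp l`. -/
def arcIntegral (m : ℝ) (A B : ℂ) (l : ℝ) : ℂ :=
  ∫ θ in (0 : ℝ)..Real.pi / 6, airyExp m A B (l - θ * Complex.I)

/-- Cauchy's theorem on the rectangle [l, h] × [-π/6, 0]; its vertical sides are the arcs |t| = e^l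
and |t| = e^h. -/
theorem integral_airyExp_eq (m : ℝ) (A B : ℂ) (l h : ℝ) :
    ∫ u in l..h, airyExp m A B u =
      (∫ u in l..h, airyExp m A B (u - (Real.pi / 6 : ℝ) * Complex.I)) +
        Complex.I * arcIntegral m A B h - Complex.I * arcIntegral m A B l := by
  have key := Complex.integral_boundary_rect_eq_zero_of_differentiableOn (airyExp m A B)
    ⟨l, -(Real.pi / 6)⟩ ⟨h, 0⟩ (differentiable_airyExp m A B).differentiableOn
  have harc : ∀ r : ℝ, ∫ y in (-(Real.pi / 6))..0, airyExp m A B (r + y * Complex.I) =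
      arcIntegral m A B r := by
    intro r
    have := intervalIntegral.integral_comp_neg (a := 0) (b := Real.pi / 6)
      fun y : ℝ => airyExp m A B (r + y * Complex.I)
    rw [neg_zero] at this
    rw [← this, arcIntegral]
    refine intervalIntegral.integral_congr fun y _ => ?_
    simp [sub_eq_add_neg]
  simp only [harc, smul_eq_mul, Complex.ofReal_zero, zero_mul, add_zero, Complex.ofReal_neg,
    neg_mul, ← sub_eq_add_neg] at key
  linear_combination -key

/-- The mechanism of Jordan's lemma: exponential decay in the angle gains a factor 1/k over the
bound at θ = 0. -/
theorem norm_integral_le_div_of_exp_decay {f : ℝ → ℂ} {D k L : ℝ} (hk : 0 < k) (hL : 0 ≤ L)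
    (hf : ∀ θ ∈ Set.Icc 0 L, ‖f θ‖ ≤ D * Real.exp (-(k * θ))) :
    ‖∫ θ in (0 : ℝ)..L, f θ‖ ≤ D / k := by
  have hD : 0 ≤ D := by
    have := (norm_nonneg _).trans (hf 0 ⟨le_rfl, hL⟩)
    simpa using this
  have h1 : ‖∫ θ in (0 : ℝ)..L, f θ‖ ≤ ∫ θ in (0 : ℝ)..L, D * Real.exp (-(k * θ)) := by
    refine intervalIntegral.norm_integral_le_of_norm_le hL
      (ae_of_all _ fun θ hθ => hf θ ⟨hθ.1.le, hθ.2⟩) ?_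
    exact Continuous.intervalIntegrable (by fun_prop) _ _
  have h2 : ∀ θ ∈ Set.uIcc 0 L, HasDerivAt (fun θ => -(D / k) * Real.exp (-(k * θ)))
      (D * Real.exp (-(k * θ))) θ := by
    intro θ _
    have h3 := ((((hasDerivAt_id θ).const_mul k).fun_neg).exp).const_mul (-(D / k))
    refine h3.congr_deriv ?_
    simp only [id]
    field_simp
  rw [intervalIntegral.integral_eq_sub_of_hasDerivAt h2
    (Continuous.intervalIntegrable (by fun_prop) _ _)] at h1
  have h4 : 0 ≤ D / k * Real.exp (-(k * L)) := by positivity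
  have h5 : Real.exp (-(k * 0)) = 1 := by simp
  rw [h5] at h1
  linarith

/-- On the arc sin 3θ ≥ (2/π) 3θ ≥ θ, as π ≤ 4. This supplies the decay linear in θ that Jordan's
lemma requires. -/
theorem norm_airyExp_le {m C : ℝ} {A B : ℂ} (hB : B.re ≤ 0) (hC : |B.im| ≤ C) (u : ℝ) {θ : ℝ}
    (hθ : θ ∈ Set.Icc 0 (Real.pi / 6)) :
    ‖airyExp m A B (u - θ * Complex.I)‖ ≤
      Real.exp (m * u + Real.exp (-u) * (A.re * Real.cos θ - A.im * Real.sin θ)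
        + Real.exp u * (C * θ) - Real.exp (3 * u) * θ / 12) := by
  have hpi := Real.pi_pos
  have hpi4 := Real.pi_le_four
  rw [norm_airyExp]
  apply Real.exp_le_exp.2
  have h1 : 2 / Real.pi * (3 * θ) ≤ Real.sin (3 * θ) :=
    Real.mul_le_sin (by linarith [hθ.1]) (by linarith [hθ.2])
  have h2 : θ ≤ 2 / Real.pi * (3 * θ) := by
    rw [div_mul_eq_mul_div, le_div_iff₀ hpi]
    nlinarith [hθ.1]
  have h3 : Real.exp (3 * u) * θ ≤ Real.exp (3 * u) * Real.sin (3 * θ) :=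
    mul_le_mul_of_nonneg_left (h2.trans h1) (Real.exp_pos _).le
  have hcos : 0 ≤ Real.cos θ := Real.cos_nonneg_of_mem_Icc ⟨by linarith [hθ.1], by linarith [hθ.2]⟩
  have hsin : 0 ≤ Real.sin θ := Real.sin_nonneg_of_mem_Icc ⟨hθ.1, by linarith [hθ.2]⟩
  have hC0 : 0 ≤ C := (abs_nonneg _).trans hC
  have h4 : B.re * Real.cos θ + B.im * Real.sin θ ≤ C * θ := by
    have h5 : B.re * Real.cos θ ≤ 0 := mul_nonpos_of_nonpos_of_nonneg hB hcos
    have h6 : B.im * Real.sin θ ≤ C * Real.sin θ :=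
      mul_le_mul_of_nonneg_right ((le_abs_self _).trans hC) hsin
    have h7 : C * Real.sin θ ≤ C * θ := mul_le_mul_of_nonneg_left (Real.sin_le hθ.1) hC0
    linarith
  have h8 := mul_le_mul_of_nonneg_left h4 (Real.exp_pos u).le
  linarith

/-- Jordan's lemma with rate e^{3u}/24 turns e^{mu} into e^{(m-3)u}, whence m < 3. -/
theorem tendsto_arcIntegral_atTop {m : ℝ} {A B : ℂ} (hm : m < 3) (hA : A.re ≤ 0) (hA' : 0 ≤ A.im)
    (hB : B.re ≤ 0) : Tendsto (arcIntegral m A B) atTop (𝓝 0) := by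
  have hpi := Real.pi_pos
  have hlim : Tendsto (fun u : ℝ => 24 * Real.exp ((m - 3) * u)) atTop (𝓝 0) := by
    rw [← mul_zero (24 : ℝ)]
    refine (Real.tendsto_exp_atBot.comp ?_).const_mul _
    exact tendsto_id.const_mul_atTop_of_neg (by linarith)
  refine squeeze_zero_norm' ?_ hlim
  -- Beyond this threshold half of the cubic decay e^{3u}/12 absorbs the linear term |Im B| e^u.
  filter_upwards [Real.tendsto_exp_atTop.eventually_ge_atTop (24 * |B.im| + 1)] with u hu
  have hv : 0 < Real.exp u := Real.exp_pos u
  have hk : 0 < Real.exp u ^ 3 / 24 := by positivity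
  have := norm_integral_le_div_of_exp_decay (f := fun θ : ℝ => airyExp m A B (u - θ * Complex.I))
    (D := Real.exp (m * u)) hk (show 0 ≤ Real.pi / 6 by positivity) ?_
  · refine this.trans (le_of_eq ?_)
    rw [sub_mul, Real.exp_sub, exp_three_mul]
    field_simp
  · intro θ hθ
    refine (norm_airyExp_le hB le_rfl u hθ).trans ?_
    rw [← Real.exp_add, exp_three_mul]
    apply Real.exp_le_exp.2
    have hcos : 0 ≤ Real.cos θ :=
      Real.cos_nonneg_of_mem_Icc ⟨by linarith [hθ.1], by linarith [hθ.2]⟩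
    have hsin : 0 ≤ Real.sin θ := Real.sin_nonneg_of_mem_Icc ⟨hθ.1, by linarith [hθ.2]⟩
    have h1 : A.re * Real.cos θ - A.im * Real.sin θ ≤ 0 := by
      nlinarith [mul_nonneg (neg_nonneg.2 hA) hcos, mul_nonneg hA' hsin]
    have h2 := mul_nonpos_of_nonneg_of_nonpos (Real.exp_pos (-u)).le h1
    have h3 : |B.im| * Real.exp u ≤ Real.exp u ^ 3 / 24 := by
      have h4 : 24 * |B.im| ≤ Real.exp u ^ 2 := by nlinarith [abs_nonneg B.im]
      nlinarith
    have h5 := mul_le_mul_of_nonneg_right h3 hθ.1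
    linarith

/-- Three mechanisms kill the small arc: the damping (Re A < 0), the power of t (m > 0), or Jordan's
lemma with rate e^{-u} Im A / 2, which turns e^{mu} into e^{(m+1)u}. The last needs m > -1, and with
m = 1 - n/2 this is the source of the restriction n ≤ 3. -/
theorem tendsto_arcIntegral_atBot {m : ℝ} {A B : ℂ} (hA : A.re ≤ 0) (hA' : 0 ≤ A.im)
    (hB : B.re ≤ 0) (h : A.re < 0 ∨ 0 < m ∨ (0 < A.im ∧ -1 < m)) :
    Tendsto (arcIntegral m A B) atBot (𝓝 0) := by
  have hpi := Real.pi_pos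
  have hpi4 := Real.pi_le_four
  have hbound : ∀ u ≤ (0 : ℝ), ∀ θ ∈ Set.Icc 0 (Real.pi / 6),
      ‖airyExp m A B (u - θ * Complex.I)‖ ≤ Real.exp (m * u + |B.im| +
        Real.exp (-u) * (A.re * (1 / 2) - A.im * (1 / 2 * θ))) := by
    intro u hu θ hθ
    refine (norm_airyExp_le hB le_rfl u hθ).trans (Real.exp_le_exp.2 ?_)
    have hcos : 1 / 2 ≤ Real.cos θ := by
      rw [← Real.cos_pi_div_three]
      exact Real.cos_le_cos_of_nonneg_of_le_pi hθ.1 (by linarith) (by linarith [hθ.2])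
    have hsin : 1 / 2 * θ ≤ Real.sin θ := by
      refine le_trans (mul_le_mul_of_nonneg_right ?_ hθ.1)
        (Real.mul_le_sin hθ.1 (by linarith [hθ.2]))
      rw [div_le_div_iff₀ two_pos hpi]
      linarith
    have h1 : A.re * Real.cos θ - A.im * Real.sin θ ≤ A.re * (1 / 2) - A.im * (1 / 2 * θ) := by
      nlinarith [mul_le_mul_of_nonneg_left hcos (neg_nonneg.2 hA),
        mul_le_mul_of_nonneg_left hsin hA']
    have h2 := mul_le_mul_of_nonneg_left h1 (Real.exp_pos (-u)).le
    have h3 : Real.exp u * (|B.im| * θ) ≤ 1 * (|B.im| * 1) :=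
      mul_le_mul (Real.exp_le_one_iff.2 hu)
        (mul_le_mul_of_nonneg_left (by linarith [hθ.2]) (abs_nonneg _))
        (mul_nonneg (abs_nonneg _) hθ.1) zero_le_one
    have h4 : 0 ≤ Real.exp (3 * u) * θ := mul_nonneg (Real.exp_pos _).le hθ.1
    linarith
  have hexp : ∀ κ : ℝ, 0 < κ → ∀ D : ℝ,
      Tendsto (fun u : ℝ => D * Real.exp (κ * u)) atBot (𝓝 0) := by
    intro κ hκ D
    rw [← mul_zero D]
    exact (Real.tendsto_exp_atBot.comp (tendsto_id.const_mul_atBot hκ)).const_mul _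
  have hpoint : (A.re < 0 ∨ 0 < m) → Tendsto (arcIntegral m A B) atBot (𝓝 0) := by
    intro h
    obtain ⟨κ, K, hκ, hK⟩ : ∃ κ K : ℝ, 0 < κ ∧ ∀ u ≤ (0 : ℝ),
        m * u + Real.exp (-u) * (A.re * (1 / 2)) ≤ K + κ * u := by
      rcases h with h | h
      · obtain ⟨K, hK⟩ := exists_mul_le_add_mul_exp (1 - m) (show 0 < -A.re * (1 / 2) by linarith)
        refine ⟨1, K, one_pos, fun u hu => ?_⟩
        have := hK (-u) (by linarith)
        linarith
      · refine ⟨m, 0, h, fun u _ => ?_⟩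
        have : Real.exp (-u) * (A.re * (1 / 2)) ≤ 0 :=
          mul_nonpos_of_nonneg_of_nonpos (Real.exp_pos _).le (by linarith)
        linarith
    refine squeeze_zero_norm' ?_ (hexp κ hκ (Real.exp (K + |B.im|) * |Real.pi / 6 - 0|))
    filter_upwards [eventually_le_atBot (0 : ℝ)] with u hu
    rw [mul_right_comm, ← Real.exp_add]
    refine intervalIntegral.norm_integral_le_of_norm_le_const fun θ hθ => ?_
    rw [Set.uIoc_of_le (by positivity)] at hθ
    refine (hbound u hu θ ⟨hθ.1.le, hθ.2⟩).trans (Real.exp_le_exp.2 ?_)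
    have h1 := hK u hu
    have h2 : 0 ≤ Real.exp (-u) * (A.im * (1 / 2 * θ)) :=
      mul_nonneg (Real.exp_pos _).le (mul_nonneg hA' (by linarith [hθ.1]))
    linarith
  rcases h with h | h | ⟨h, hm⟩
  · exact hpoint (Or.inl h)
  · exact hpoint (Or.inr h)
  · refine squeeze_zero_norm' ?_ (hexp (m + 1) (by linarith) (Real.exp |B.im| * (2 / A.im)))
    filter_upwards [eventually_le_atBot (0 : ℝ)] with u hu
    have := norm_integral_le_div_of_exp_decay (f := fun θ : ℝ => airyExp m A B (u - θ * Complex.I))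
      (D := Real.exp (m * u + |B.im|)) (k := Real.exp (-u) * (A.im * (1 / 2)))
      (by positivity) (show 0 ≤ Real.pi / 6 by positivity) ?_
    · refine this.trans (le_of_eq ?_)
      rw [add_mul, Real.exp_add, Real.exp_add, Real.exp_neg, one_mul]
      field_simp
    · intro θ hθ
      refine (hbound u hu θ hθ).trans ?_
      rw [← Real.exp_add]
      apply Real.exp_le_exp.2
      have h2 : Real.exp (-u) * (A.re * (1 / 2)) ≤ 0 :=
        mul_nonpos_of_nonneg_of_nonpos (Real.exp_pos _).le (by linarith)
      linarith

theorem tendsto_integral_airyExp {m : ℝ} {A B : ℂ} (hm : m < 3) (hA : A.re ≤ 0) (hA' : 0 ≤ A.im)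
    (hB : B.re ≤ 0) (h : 0 < A.im ∨ 0 < m) (h' : A.re < 0 ∨ 0 < m ∨ (0 < A.im ∧ -1 < m))
    {ι : Type*} {F : Filter ι} [F.IsCountablyGenerated] {l r : ι → ℝ}
    (hl : Tendsto l F atBot) (hr : Tendsto r F atTop) :
    Tendsto (fun i => ∫ u in l i..r i, airyExp m A B u) F (𝓝 (rotatedIntegral m A B)) := by
  have h1 := intervalIntegral_tendsto_integral (integrable_airyExp_rotated hA hA' hB h) hl hr
  have h2 := ((tendsto_arcIntegral_atTop hm hA hA' hB).comp hr).const_mul Complex.I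
  have h3 := ((tendsto_arcIntegral_atBot hA hA' hB h').comp hl).const_mul Complex.I
  have h4 := (h1.add h2).sub h3
  simp only [mul_zero, add_zero, sub_zero] at h4
  refine h4.congr fun i => ?_
  rw [integral_airyExp_eq]
  rfl

/-- For a damped integrand the rotation of the contour is exact. -/
theorem integral_airyExp_eq_rotatedIntegral {m : ℝ} {A B : ℂ} (hm : m < 3) (hA : A.re < 0)
    (hA' : 0 ≤ A.im) (hB : B.re < 0) (h : 0 < A.im ∨ 0 < m) :
    Integrable (fun u : ℝ => airyExp m A B u) ∧
      ∫ u : ℝ, airyExp m A B u = rotatedIntegral m A B := by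
  have hint : Integrable (fun u : ℝ => airyExp m A B u) := by
    refine Integrable.mono' (integrable_exp_two_sided (m := m) (p := -A.re) (b := -B.re)
      (by linarith) (by linarith) (Or.inl (by linarith)))
      (Continuous.aestronglyMeasurable (by fun_prop)) (ae_of_all _ fun u => ?_)
    have := norm_airyExp m A B u 0
    simp only [Complex.ofReal_zero, zero_mul, sub_zero, Real.cos_zero, Real.sin_zero, mul_zero,
      mul_one, zero_div, add_zero] at this
    rw [this]
    apply Real.exp_le_exp.2
    linarith
  refine ⟨hint, tendsto_nhds_unique
    (intervalIntegral_tendsto_integral hint tendsto_neg_atTop_atBot tendsto_id) ?_⟩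
  exact tendsto_integral_airyExp hm hA.le hA' hB.le h (Or.inl hA) tendsto_neg_atTop_atBot
    tendsto_id

/-! ### The oscillatory integral of the kernel -/

section Kernel

variable {n : ℕ}

/-- Coefficient of `1 / t` in the damped exponent. -/
def coeffInv (x y : EuclideanSpace ℝ (Fin n)) (a : ℝ) : ℂ :=
  Complex.I * ((‖x - y‖ ^ 2 / 4 : ℝ) : ℂ) - a

@[simp] theorem coeffInv_re (x y : EuclideanSpace ℝ (Fin n)) (a : ℝ) :
    (coeffInv x y a).re = -a := by simp [coeffInv, -Complex.ofReal_div, -Complex.ofReal_pow]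

@[simp] theorem coeffInv_im (x y : EuclideanSpace ℝ (Fin n)) (a : ℝ) :
    (coeffInv x y a).im = ‖x - y‖ ^ 2 / 4 := by
  simp [coeffInv, -Complex.ofReal_div, -Complex.ofReal_pow]

/-- The exponent is 1 - n/2 because the Jacobian of t = e^u adds one to -n/2. It is positive only
for n = 1, where x = y is allowed. -/
theorem coeff_pos_or {x y : EuclideanSpace ℝ (Fin n)} (h : x ≠ y ∨ n = 1) (a : ℝ) :
    0 < (coeffInv x y a).im ∨ 0 < (1 - n / 2 : ℝ) := by
  rcases h with h | h
  · left
    have : 0 < ‖x - y‖ := norm_pos_iff.2 (sub_ne_zero.2 h)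
    rw [coeffInv_im]
    positivity
  · right
    rw [h]
    norm_num

theorem half_dim_lt : (1 - n / 2 : ℝ) < 3 := by
  have : (0 : ℝ) ≤ n := Nat.cast_nonneg n
  linarith

/-! ### An integrable majorant -/

/-- A majorant of the damped kernels, uniform in the damping. -/
def majorant (y x : EuclideanSpace ℝ (Fin n)) : ℝ :=
  ∫ u : ℝ, Real.exp ((1 - n / 2) * u - ‖x - y‖ ^ 2 / 4 / 2 * Real.exp (-u) - 1 * Real.exp u)

/-- By Tonelli: for fixed u the Gaussian integral in x is (8π e^u)^{n/2}, which cancels e^{-nu/2}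
exactly and leaves a multiple of e^{u - e^u}. -/
theorem integrable_majorant (y : EuclideanSpace ℝ (Fin n)) : Integrable (majorant y) := by
  have hgauss : ∀ u : ℝ,
      Integrable (fun x : EuclideanSpace ℝ (Fin n) =>
        Real.exp ((1 - n / 2) * u - ‖x - y‖ ^ 2 / 4 / 2 * Real.exp (-u) - 1 * Real.exp u)) ∧
      ∫ x : EuclideanSpace ℝ (Fin n),
        Real.exp ((1 - n / 2) * u - ‖x - y‖ ^ 2 / 4 / 2 * Real.exp (-u) - 1 * Real.exp u) =
        (8 * Real.pi) ^ ((n : ℝ) / 2) *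
          Real.exp (1 * u - 0 * Real.exp (-u) - 1 * Real.exp u) := by
    intro u
    have hb : 0 < Real.exp (-u) / 8 := by positivity
    have hfun : (fun x : EuclideanSpace ℝ (Fin n) =>
        Real.exp ((1 - n / 2) * u - ‖x - y‖ ^ 2 / 4 / 2 * Real.exp (-u) - 1 * Real.exp u)) =
        fun x => Real.exp ((1 - n / 2) * u - Real.exp u) *
          Real.exp (-(Real.exp (-u) / 8) * ‖x - y‖ ^ 2) := by
      ext x
      rw [← Real.exp_add]
      congr 1
      ring
    have hint : Integrable fun x : EuclideanSpace ℝ (Fin n) =>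
        Real.exp (-(Real.exp (-u) / 8) * ‖x‖ ^ 2) := by
      have := (GaussianFourier.integrable_cexp_neg_mul_sq_norm_add
        (V := EuclideanSpace ℝ (Fin n)) (b := ((Real.exp (-u) / 8 : ℝ) : ℂ))
        (by rwa [Complex.ofReal_re]) 0 0).norm
      refine this.congr (ae_of_all _ fun x => ?_)
      simp only [Complex.norm_exp]
      congr 1
      simp [← Complex.ofReal_pow, -Complex.ofReal_exp, -Complex.ofReal_div]
    rw [hfun]
    refine ⟨(hint.comp_sub_right y).const_mul _, ?_⟩
    rw [integral_const_mul, integral_sub_right_eq_self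
      (fun x : EuclideanSpace ℝ (Fin n) => Real.exp (-(Real.exp (-u) / 8) * ‖x‖ ^ 2)) y,
      GaussianFourier.integral_rexp_neg_mul_sq_norm hb, finrank_euclideanSpace_fin,
      show Real.pi / (Real.exp (-u) / 8) = 8 * Real.pi * Real.exp u by
        rw [Real.exp_neg]; field_simp,
      Real.mul_rpow (by positivity) (Real.exp_pos u).le, ← Real.exp_mul, mul_left_comm,
      ← Real.exp_add]
    congr 2
    ring
  have hprod : Integrable (fun p : EuclideanSpace ℝ (Fin n) × ℝ =>
      Real.exp ((1 - n / 2) * p.2 - ‖p.1 - y‖ ^ 2 / 4 / 2 * Real.exp (-p.2) - 1 * Real.exp p.2))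
      (volume.prod volume) := by
    rw [integrable_prod_iff' (Continuous.aestronglyMeasurable (by fun_prop))]
    refine ⟨ae_of_all _ fun u => (hgauss u).1, ?_⟩
    simp only [Real.norm_eq_abs, Real.abs_exp, (hgauss _).2]
    exact (integrable_exp_two_sided one_pos le_rfl (Or.inr one_pos)).const_mul _
  exact hprod.integral_prod_left

/-! ### The kernel in logarithmic coordinates. -/

variable [NeZero n]

/-- Coefficient of `t` in the damped exponent. -/
def coeffLin (E : ℝ) (x y : EuclideanSpace ℝ (Fin n)) (b : ℝ) : ℂ :=
  Complex.I * (((vert x + vert y) / 2 + E : ℝ) : ℂ) - b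

@[simp] theorem coeffLin_re (E : ℝ) (x y : EuclideanSpace ℝ (Fin n)) (b : ℝ) :
    (coeffLin E x y b).re = -b := by
  simp [coeffLin, -Complex.ofReal_div, -Complex.ofReal_add]

@[simp] theorem coeffLin_im (E : ℝ) (x y : EuclideanSpace ℝ (Fin n)) (b : ℝ) :
    (coeffLin E x y b).im = (vert x + vert y) / 2 + E := by
  simp [coeffLin, -Complex.ofReal_div, -Complex.ofReal_add]

theorem exp_mul_damped_kernelIntegrand (E : ℝ) (x y : EuclideanSpace ℝ (Fin n)) (a b u : ℝ) :
    Real.exp u • damped (kernelIntegrand E x y) a b (Real.exp u) =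
      airyExp (1 - n / 2) (coeffInv x y a) (coeffLin E x y b) u := by
  have hne : Complex.exp u ≠ 0 := Complex.exp_ne_zero _
  have h1 : (Real.exp u) ^ (-((n : ℝ) / 2)) = Real.exp (u * (-((n : ℝ) / 2))) := (Real.exp_mul _ _).symm
  rw [damped, kernelIntegrand, h1, airyExp, Complex.real_smul, Complex.ofReal_exp,
    Complex.ofReal_exp, Complex.ofReal_exp, ← Complex.exp_add, ← Complex.exp_add, ← Complex.exp_add]
  congr 1
  have h3 : Complex.exp (3 * u) = Complex.exp u ^ 3 := by rw [← Complex.exp_nat_mul]; norm_num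
  rw [h3, Complex.exp_neg, coeffInv, coeffLin, phase]
  push_cast
  field_simp
  ring

theorem damped_zero_zero (f : ℝ → ℂ) : damped f 0 0 = f := by
  ext t; simp [damped]

theorem integral_damped_kernelIntegrand {E : ℝ} {x y : EuclideanSpace ℝ (Fin n)}
    (h : x ≠ y ∨ n = 1) {a b : ℝ} (ha : 0 < a) (hb : 0 < b) :
    IntegrableOn (damped (kernelIntegrand E x y) a b) (Set.Ioi 0) ∧
      ∫ t in Set.Ioi (0 : ℝ), damped (kernelIntegrand E x y) a b t =
        rotatedIntegral (1 - n / 2) (coeffInv x y a) (coeffLin E x y b) := by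
  have himg : Real.exp '' Set.univ = Set.Ioi 0 := by
    rw [Set.image_univ, Real.range_exp]
  have hderiv : ∀ u ∈ (Set.univ : Set ℝ), HasDerivWithinAt Real.exp (Real.exp u) Set.univ u :=
    fun u _ => (Real.hasDerivAt_exp u).hasDerivWithinAt
  have hinj : Set.InjOn Real.exp Set.univ := Real.exp_injective.injOn
  have hrot := integral_airyExp_eq_rotatedIntegral (half_dim_lt (n := n))
    (A := coeffInv x y a) (B := coeffLin E x y b) (by simpa using ha)
    (by rw [coeffInv_im]; positivity) (by simpa using hb) (coeff_pos_or h a)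
  have hfun : (fun u : ℝ => |Real.exp u| • damped (kernelIntegrand E x y) a b (Real.exp u)) =
      fun u : ℝ => airyExp (1 - n / 2) (coeffInv x y a) (coeffLin E x y b) u := by
    ext u
    rw [Real.abs_exp, exp_mul_damped_kernelIntegrand]
  constructor
  · rw [← himg, integrableOn_image_iff_integrableOn_abs_deriv_smul MeasurableSet.univ hderiv hinj,
      hfun, integrableOn_univ]
    exact hrot.1
  · rw [← himg, integral_image_eq_integral_abs_deriv_smul MeasurableSet.univ hderiv hinj, hfun,
      setIntegral_univ, hrot.2]

theorem continuousOn_kernelIntegrand (E : ℝ) (x y : EuclideanSpace ℝ (Fin n)) :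
    ContinuousOn (kernelIntegrand E x y) (Set.Ioi 0) := by
  intro t ht
  have ht0 : t ≠ 0 := (Set.mem_Ioi.1 ht).ne'
  apply ContinuousAt.continuousWithinAt
  unfold kernelIntegrand phase
  have h1 : ContinuousAt (fun t : ℝ => t ^ (-((n : ℝ) / 2))) t :=
    Real.continuousAt_rpow_const _ _ (Or.inl ht0)
  have h2 : ContinuousAt (fun t : ℝ => ‖x - y‖ ^ 2 / (4 * t) +
      ((vert x + vert y) / 2 + E) * t - t ^ 3 / 12) t := by
    refine ContinuousAt.sub (ContinuousAt.add ?_ (by fun_prop)) (by fun_prop)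
    exact ContinuousAt.div (by fun_prop) (by fun_prop) (by simpa using ht0)
  exact (Complex.continuous_ofReal.continuousAt.comp h1).mul
    (Complex.continuous_exp.continuousAt.comp
      (continuousAt_const.mul (Complex.continuous_ofReal.continuousAt.comp h2)))

theorem intervalIntegral_kernelIntegrand (E : ℝ) (x y : EuclideanSpace ℝ (Fin n)) {α β : ℝ}
    (hα : 0 < α) (hβ : 0 < β) :
    ∫ t in α..β, kernelIntegrand E x y t =
      ∫ u in Real.log α..Real.log β,
        airyExp (1 - n / 2) (coeffInv x y 0) (coeffLin E x y 0) u := by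
  have h := intervalIntegral.integral_deriv_smul_comp' (a := Real.log α) (b := Real.log β)
    (f := Real.exp) (f' := Real.exp) (g := kernelIntegrand E x y)
    (fun u _ => Real.hasDerivAt_exp u) Real.continuous_exp.continuousOn
    ((continuousOn_kernelIntegrand E x y).mono (by
      rintro _ ⟨u, _, rfl⟩
      exact Real.exp_pos u))
  rw [Real.exp_log hα, Real.exp_log hβ] at h
  rw [← h]
  refine intervalIntegral.integral_congr fun u _ => ?_
  simp only [Function.comp]
  rw [← exp_mul_damped_kernelIntegrand, damped_zero_zero]

/-- The value of the kernel as an absolutely convergent integral. -/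
theorem hasOscillatoryIntegral_kernelIntegrand (E : ℝ) {x y : EuclideanSpace ℝ (Fin n)}
    (h : x ≠ y ∨ n = 1) :
    HasOscillatoryIntegral (kernelIntegrand E x y)
      (rotatedIntegral (1 - n / 2) (coeffInv x y 0) (coeffLin E x y 0)) := by
  refine ⟨fun a b ha hb => (integral_damped_kernelIntegrand h ha hb).1, ?_⟩
  have hpos : ∀ᶠ p : ℝ × ℝ in 𝓝[>] 0 ×ˢ 𝓝[>] 0, 0 < p.1 ∧ 0 < p.2 := by
    exact (eventually_mem_nhdsWithin (a := (0 : ℝ)) (s := Set.Ioi 0)).prod_mk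
      (eventually_mem_nhdsWithin (a := (0 : ℝ)) (s := Set.Ioi 0))
  have hcoeff : Tendsto (fun p : ℝ × ℝ => (coeffInv x y p.1, coeffLin E x y p.2))
      (𝓝[>] 0 ×ˢ 𝓝[>] 0)
      (𝓝[{z | z.1.re ≤ 0 ∧ 0 ≤ z.1.im ∧ z.2.re ≤ 0}] (coeffInv x y 0, coeffLin E x y 0)) := by
    refine tendsto_nhdsWithin_iff.2 ⟨?_, ?_⟩
    · have hc : Continuous fun p : ℝ × ℝ => (coeffInv x y p.1, coeffLin E x y p.2) := by
        unfold coeffInv coeffLin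
        fun_prop
      refine (hc.tendsto ((0 : ℝ), (0 : ℝ))).mono_left ?_
      rw [nhds_prod_eq]
      exact Filter.prod_mono nhdsWithin_le_nhds nhdsWithin_le_nhds
    · filter_upwards [hpos] with p hp
      simp only [coeffInv_re, coeffInv_im, coeffLin_re]
      exact ⟨by linarith [hp.1], by positivity, by linarith [hp.2]⟩
  have hlim := (continuousWithinAt_rotatedIntegral (B₀ := coeffLin E x y 0)
    (coeff_pos_or h 0)).tendsto.comp hcoeff
  refine hlim.congr' ?_
  filter_upwards [hpos] with p hp
  exact (integral_damped_kernelIntegrand h hp.1 hp.2).2.symm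

theorem hasImproperIntegral_kernelIntegrand (E : ℝ) {x y : EuclideanSpace ℝ (Fin n)}
    (h : x ≠ y ∨ n = 1) (hn : n ≤ 3) :
    HasImproperIntegral (kernelIntegrand E x y)
      (rotatedIntegral (1 - n / 2) (coeffInv x y 0) (coeffLin E x y 0)) := by
  constructor
  · intro a b ha hab
    refine ((continuousOn_kernelIntegrand E x y).mono fun t ht => ?_).intervalIntegrable
    rw [Set.uIcc_of_le hab] at ht
    exact ha.trans_le ht.1
  · have hn' : (n : ℝ) ≤ 3 := by exact_mod_cast hn
    -- Without damping the first alternative is unavailable; n ≤ 3 gives 1 - n/2 ≥ -1/2 > -1 for the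
    -- third.
    have h' : (coeffInv x y 0).re < 0 ∨ 0 < (1 - n / 2 : ℝ) ∨
        (0 < (coeffInv x y 0).im ∧ -1 < (1 - n / 2 : ℝ)) := by
      rcases coeff_pos_or h 0 with h | h
      · exact Or.inr (Or.inr ⟨h, by linarith⟩)
      · exact Or.inr (Or.inl h)
    have hlim := tendsto_integral_airyExp (half_dim_lt (n := n)) (A := coeffInv x y 0)
      (B := coeffLin E x y 0) (by simp) (by rw [coeffInv_im]; positivity) (by simp)
      (coeff_pos_or h 0) h' (F := 𝓝[>] (0 : ℝ) ×ˢ atTop)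
      (Real.tendsto_log_nhdsGT_zero.comp tendsto_fst) (Real.tendsto_log_atTop.comp tendsto_snd)
    refine hlim.congr' ?_
    have hpos : ∀ᶠ p : ℝ × ℝ in 𝓝[>] 0 ×ˢ atTop, 0 < p.1 ∧ 0 < p.2 :=
      (eventually_mem_nhdsWithin (a := (0 : ℝ)) (s := Set.Ioi 0)).prod_mk (eventually_gt_atTop 0)
    filter_upwards [hpos] with p hp
    exact (intervalIntegral_kernelIntegrand E x y hp.1 hp.2).symm

theorem oscillatoryIntegral_kernelIntegrand (E : ℝ) {x y : EuclideanSpace ℝ (Fin n)}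
    (h : x ≠ y ∨ n = 1) :
    oscillatoryIntegral (kernelIntegrand E x y) =
      rotatedIntegral (1 - n / 2) (coeffInv x y 0) (coeffLin E x y 0) :=
  (hasOscillatoryIntegral_kernelIntegrand E h).eq

/-! ### Continuity and local integrability of the kernel. -/

theorem continuous_vert : Continuous (vert : EuclideanSpace ℝ (Fin n) → ℝ) := by
  unfold vert
  fun_prop

theorem continuousOn_kernel (E : ℝ) (y : EuclideanSpace ℝ (Fin n)) :
    ContinuousOn (fun x => kernel E x y) {x | x ≠ y} := by
  have hc : Continuous fun x : EuclideanSpace ℝ (Fin n) =>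
      (coeffInv x y 0, coeffLin E x y 0) := by
    have := continuous_vert (n := n)
    unfold coeffInv coeffLin
    fun_prop
  have h : ContinuousOn (fun x : EuclideanSpace ℝ (Fin n) =>
      rotatedIntegral (1 - n / 2) (coeffInv x y 0) (coeffLin E x y 0)) {x | x ≠ y} := by
    intro x hx
    have hx' := continuousWithinAt_rotatedIntegral (B₀ := coeffLin E x y 0)
      (coeff_pos_or (n := n) (Or.inl hx) 0)
    refine hx'.comp (f := fun x : EuclideanSpace ℝ (Fin n) => (coeffInv x y 0, coeffLin E x y 0))
      hc.continuousWithinAt fun z _ => ?_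
    exact ⟨by simp, by rw [coeffInv_im]; positivity, by simp⟩
  refine ((continuousOn_const (c := Complex.I / (4 * (Real.pi : ℂ) * Complex.I) ^ ((n : ℂ) / 2))).mul
    h).congr fun x hx => ?_
  rw [kernel, oscillatoryIntegral_kernelIntegrand E (Or.inl hx)]
  rfl

theorem norm_rotatedIntegral_coeff_le {E C : ℝ} {x y : EuclideanSpace ℝ (Fin n)} (hx : x ≠ y)
    {a b : ℝ} (ha : 0 ≤ a) (hb : 0 ≤ b) (hC : |(vert x + vert y) / 2 + E| ≤ C) :
    ‖rotatedIntegral (1 - n / 2) (coeffInv x y a) (coeffLin E x y b)‖ ≤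
      Real.exp ((C + 2) ^ 3) * majorant y x := by
  have hpos : 0 < ‖x - y‖ := norm_pos_iff.2 (sub_ne_zero.2 hx)
  exact norm_rotatedIntegral_le (by simpa using ha) (by simp) (by simpa using hb) (by simpa using hC)
    (by positivity) (Or.inl (by positivity))

theorem ae_ne (y : EuclideanSpace ℝ (Fin n)) : ∀ᵐ x : EuclideanSpace ℝ (Fin n), x ≠ y := by
  have : Nonempty (Fin n) := ⟨⟨0, Nat.pos_of_ne_zero (NeZero.ne n)⟩⟩
  have : Nontrivial (EuclideanSpace ℝ (Fin n)) := by infer_instance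
  exact Measure.ae_ne volume y

theorem aestronglyMeasurable_kernel (E : ℝ) (y : EuclideanSpace ℝ (Fin n)) :
    AEStronglyMeasurable (fun x => kernel E x y) := by
  have h : AEStronglyMeasurable (fun x => kernel E x y)
      (volume.restrict {x : EuclideanSpace ℝ (Fin n) | x ≠ y}) :=
    (continuousOn_kernel E y).aestronglyMeasurable (measurableSet_singleton y).compl
  rwa [Measure.restrict_eq_self_of_ae_mem
    (s := {x : EuclideanSpace ℝ (Fin n) | x ≠ y}) (ae_ne y)] at h

theorem locallyIntegrable_kernel (E : ℝ) (y : EuclideanSpace ℝ (Fin n)) :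
    LocallyIntegrable (fun x => kernel E x y) := by
  rw [locallyIntegrable_iff]
  intro k hk
  have hcont : Continuous fun x : EuclideanSpace ℝ (Fin n) => |(vert x + vert y) / 2 + E| := by
    have := continuous_vert (n := n)
    fun_prop
  obtain ⟨C, hC⟩ := hk.bddAbove_image hcont.continuousOn
  refine Integrable.mono' ((((integrable_majorant y).const_mul (Real.exp ((C + 2) ^ 3))).const_mul
    ‖Complex.I / (4 * (Real.pi : ℂ) * Complex.I) ^ ((n : ℂ) / 2)‖).integrableOn (s := k))
    (aestronglyMeasurable_kernel E y).restrict ?_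
  filter_upwards [ae_restrict_of_ae (ae_ne y), ae_restrict_mem hk.measurableSet] with x hx hxk
  rw [kernel, norm_mul, oscillatoryIntegral_kernelIntegrand E (Or.inl hx)]
  exact mul_le_mul_of_nonneg_left (norm_rotatedIntegral_coeff_le hx le_rfl le_rfl
    (hC ⟨x, hxk, rfl⟩)) (norm_nonneg _)

end Kernel

/-! ### Multiplication by unimodular functions and by polynomials -/

section Schwartz

open FourierTransform LineDeriv Laplacian

/-- Supplying the whole chain of derivatives as one sequence makes each iterated derivative a later,
bounded term. It serves e^{is} and the divided difference below. -/
theorem hasTemperateGrowth_of_hasDerivAt {F : ℕ → ℝ → ℂ}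
    (hF : ∀ k z, HasDerivAt (F k) (F (k + 1) z) z) (hb : ∀ k, ∃ C : ℝ, ∀ z, ‖F k z‖ ≤ C) (k : ℕ) :
    (F k).HasTemperateGrowth := by
  have hiter : ∀ j k : ℕ, iteratedDeriv j (F k) = F (k + j) := by
    intro j
    induction j with
    | zero => intro k; simp
    | succ j ih =>
      intro k
      rw [iteratedDeriv_succ, ih k]
      ext z
      exact (hF (k + j) z).deriv
  have hdiff : ∀ k, Differentiable ℝ (F k) := fun k z => (hF k z).differentiableAt
  refine ⟨contDiff_of_differentiable_iteratedDeriv fun j _ => ?_, fun j => ?_⟩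
  · rw [hiter]
    exact hdiff _
  · obtain ⟨C, hC⟩ := hb (k + j)
    refine ⟨0, C, fun z => ?_⟩
    rw [norm_iteratedFDeriv_eq_norm_iteratedDeriv, hiter, pow_zero, mul_one]
    exact hC z

theorem hasTemperateGrowth_cexp_I_mul :
    (fun s : ℝ => Complex.exp (Complex.I * s)).HasTemperateGrowth := by
  have h := hasTemperateGrowth_of_hasDerivAt
    (F := fun k s => Complex.I ^ k * Complex.exp (Complex.I * s)) (fun k z => ?_)
    (fun k => ⟨1, fun z => ?_⟩) 0
  · simpa using h
  · have h1 : HasDerivAt (fun s : ℝ => Complex.I * (s : ℂ)) Complex.I z := by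
      simpa using (Complex.ofRealCLM.hasDerivAt (x := z)).const_mul Complex.I
    refine (h1.cexp.const_mul (Complex.I ^ k)).congr_deriv ?_
    ring
  · rw [norm_mul, norm_pow, Complex.norm_I, one_pow, one_mul, mul_comm, Complex.norm_exp_ofReal_mul_I]

variable {V : Type*} [NormedAddCommGroup V] [InnerProductSpace ℝ V]

theorem hasTemperateGrowth_expI {p : V → ℝ} (hp : p.HasTemperateGrowth) :
    (fun ξ => Complex.exp (Complex.I * p ξ)).HasTemperateGrowth :=
  hasTemperateGrowth_cexp_I_mul.comp hp

theorem hasTemperateGrowth_inner_ofReal (e : V) :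
    (fun x : V => ((inner ℝ x e : ℝ) : ℂ)).HasTemperateGrowth :=
  Function.HasTemperateGrowth.comp Complex.ofRealCLM.hasTemperateGrowth
    (Function.hasTemperateGrowth_inner_left e)

theorem hasTemperateGrowth_norm_sq_ofReal :
    (fun x : V => ((‖x‖ ^ 2 : ℝ) : ℂ)).HasTemperateGrowth :=
  Function.HasTemperateGrowth.comp Complex.ofRealCLM.hasTemperateGrowth
    (Function.hasTemperateGrowth_norm_sq V)

/-- Multiplication by the coordinate `⟪x, e⟫`. -/
def mulCoord (e : V) : 𝓢(V, ℂ) →L[ℂ] 𝓢(V, ℂ) :=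
  SchwartzMap.smulLeftCLM ℂ fun x : V => ((inner ℝ x e : ℝ) : ℂ)

/-- Multiplication by `‖x‖²`. -/
def mulNormSq : 𝓢(V, ℂ) →L[ℂ] 𝓢(V, ℂ) :=
  SchwartzMap.smulLeftCLM ℂ fun x : V => ((‖x‖ ^ 2 : ℝ) : ℂ)

@[simp] theorem mulCoord_apply (e : V) (g : 𝓢(V, ℂ)) (x : V) :
    mulCoord e g x = (inner ℝ x e : ℝ) * g x := by
  rw [mulCoord, smulLeftCLM_apply_apply (hasTemperateGrowth_inner_ofReal e), smul_eq_mul]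

@[simp] theorem mulNormSq_apply (g : 𝓢(V, ℂ)) (x : V) :
    mulNormSq g x = (‖x‖ ^ 2 : ℝ) * g x := by
  rw [mulNormSq, smulLeftCLM_apply_apply hasTemperateGrowth_norm_sq_ofReal, smul_eq_mul]

variable [FiniteDimensional ℝ V] [MeasurableSpace V] [BorelSpace V]

theorem fourier_mulCoord (e : V) (φ : 𝓢(V, ℂ)) :
    (2 * Real.pi * Complex.I) • 𝓕 (mulCoord e φ) = -∂_{e} (𝓕 φ) := by
  rw [SchwartzMap.lineDerivOp_fourier_eq, neg_smul, FourierTransform.fourier_neg, neg_neg,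
    FourierTransform.fourier_smul]
  congr 2
  exact SchwartzMap.smulLeftCLM_ofReal ℂ (Function.hasTemperateGrowth_inner_left e) φ

theorem fourier_laplacian (φ : 𝓢(V, ℂ)) :
    𝓕 (Δ φ) = -(4 * Real.pi ^ 2 : ℂ) • mulNormSq (𝓕 φ) := by
  have hg : (fun x : V => ‖x‖ ^ 2).HasTemperateGrowth := by fun_prop
  have h : 𝓕 (Δ φ) = (-(2 * Real.pi) ^ 2 : ℝ) • SchwartzMap.smulLeftCLM ℂ (fun x : V => ‖x‖ ^ 2)
      (𝓕 φ) := by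
    rw [SchwartzMap.laplacian_eq_fourierMultiplierCLM, fourierMultiplierCLM_apply,
      FourierTransform.fourier_smul, FourierTransform.fourier_fourierInv_eq]
  rw [h]
  ext x
  rw [_root_.smul_apply, _root_.smul_apply, smulLeftCLM_apply_apply hg, mulNormSq_apply,
    Complex.real_smul, Complex.real_smul, smul_eq_mul]
  push_cast
  ring

theorem integrable_expI_mul {p : V → ℝ} (hp : Continuous p) {f : V → ℂ} (hf : Integrable f) :
    Integrable fun ξ => Complex.exp (Complex.I * p ξ) * f ξ := by
  refine hf.norm.mono' ((Continuous.aestronglyMeasurable (by fun_prop)).mul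
    hf.aestronglyMeasurable) (ae_of_all _ fun ξ => ?_)
  rw [norm_mul, mul_comm Complex.I, Complex.norm_exp_ofReal_mul_I, one_mul]

end Schwartz

section Propagator

open FourierTransform LineDeriv Laplacian

variable {V : Type*} [NormedAddCommGroup V] [InnerProductSpace ℝ V]

/-! ### The propagator of the Stark Hamiltonian in momentum space -/

/-- The phase of the propagator in momentum space. -/
def chirp (y e : V) (t : ℝ) (ξ : V) : ℝ :=
  2 * Real.pi * inner ℝ ξ y - 4 * Real.pi ^ 2 * t * ‖ξ‖ ^ 2 - 2 * Real.pi * t ^ 2 * inner ℝ ξ e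

@[fun_prop]
theorem continuous_chirp (y e : V) (t : ℝ) : Continuous (chirp y e t) := by
  unfold chirp
  fun_prop

theorem hasFDerivAt_chirp (y e : V) (t : ℝ) (ξ : V) :
    HasFDerivAt (chirp y e t)
      ((2 * Real.pi) • (innerSL ℝ).flip y - (4 * Real.pi ^ 2 * t) • (2 • innerSL ℝ ξ)
        - (2 * Real.pi * t ^ 2) • (innerSL ℝ).flip e) ξ := by
  have h1 : ∀ z : V, HasFDerivAt (fun ξ : V => (inner ℝ ξ z : ℝ)) ((innerSL ℝ).flip z) ξ :=
    fun z => ((innerSL ℝ).flip z).hasFDerivAt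
  have h2 : HasFDerivAt (fun ξ : V => ‖ξ‖ ^ 2) (2 • innerSL ℝ ξ) ξ :=
    (hasStrictFDerivAt_norm_sq ξ).hasFDerivAt
  exact (((h1 y).const_mul _).sub (h2.const_mul _)).sub ((h1 e).const_mul _)

variable [FiniteDimensional ℝ V] [MeasurableSpace V] [BorelSpace V]

/-- The integral of `g` against `exp (i chirp)`. -/
def chirpIntegral (y e : V) (g : 𝓢(V, ℂ)) (t : ℝ) : ℂ :=
  ∫ ξ, Complex.exp (Complex.I * chirp y e t ξ) * g ξ

theorem integrable_chirp_mul (y e : V) (g : 𝓢(V, ℂ)) (t : ℝ) :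
    Integrable fun ξ => Complex.exp (Complex.I * chirp y e t ξ) * g ξ :=
  integrable_expI_mul (continuous_chirp y e t) g.integrable

theorem chirpIntegral_add (y e : V) (g h : 𝓢(V, ℂ)) (t : ℝ) :
    chirpIntegral y e (g + h) t = chirpIntegral y e g t + chirpIntegral y e h t := by
  simp only [chirpIntegral, _root_.add_apply, mul_add]
  exact integral_add (integrable_chirp_mul y e g t) (integrable_chirp_mul y e h t)

theorem chirpIntegral_smul (y e : V) (c : ℂ) (g : 𝓢(V, ℂ)) (t : ℝ) :
    chirpIntegral y e (c • g) t = c * chirpIntegral y e g t := by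
  simp only [chirpIntegral, _root_.smul_apply, smul_eq_mul, mul_left_comm _ c]
  exact integral_const_mul _ _

theorem norm_chirpIntegral_le (y e : V) (g : 𝓢(V, ℂ)) (t : ℝ) :
    ‖chirpIntegral y e g t‖ ≤ ‖g.toLp 1‖ := by
  rw [norm_toLp_one]
  refine (norm_integral_le_integral_norm _).trans (le_of_eq ?_)
  congr 1 with ξ
  rw [norm_mul, mul_comm Complex.I, Complex.norm_exp_ofReal_mul_I, one_mul]

/-- Integration by parts in the direction `e`. -/
theorem chirpIntegral_lineDerivOp (y : V) {e : V} (he : ‖e‖ = 1) (g : 𝓢(V, ℂ)) (t : ℝ) :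
    chirpIntegral y e (∂_{e} g) t =
      -(2 * Real.pi * Complex.I * ((inner ℝ y e : ℝ) - t ^ 2)) * chirpIntegral y e g t
        + 8 * Real.pi ^ 2 * Complex.I * t * chirpIntegral y e (mulCoord e g) t := by
  have hexp : ∀ ξ, HasFDerivAt (fun ξ => Complex.exp (Complex.I * chirp y e t ξ))
      (Complex.exp (Complex.I * chirp y e t ξ) • Complex.I • Complex.ofRealCLM ∘L
        ((2 * Real.pi) • (innerSL ℝ).flip y - (4 * Real.pi ^ 2 * t) • (2 • innerSL ℝ ξ)
        - (2 * Real.pi * t ^ 2) • (innerSL ℝ).flip e)) ξ := fun ξ =>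
    ((Complex.ofRealCLM.hasFDerivAt.comp ξ (hasFDerivAt_chirp y e t ξ)).const_mul Complex.I).cexp
  have hval : ∀ ξ, fderiv ℝ (fun ξ => Complex.exp (Complex.I * chirp y e t ξ)) ξ e * g ξ =
      2 * Real.pi * Complex.I * ((inner ℝ y e : ℝ) - t ^ 2) *
          (Complex.exp (Complex.I * chirp y e t ξ) * g ξ)
        - 8 * Real.pi ^ 2 * Complex.I * t *
          (Complex.exp (Complex.I * chirp y e t ξ) * mulCoord e g ξ) := by
    intro ξ
    rw [(hexp ξ).fderiv, mulCoord_apply]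
    simp only [_root_.smul_apply, ContinuousLinearMap.comp_apply,
      _root_.sub_apply, ContinuousLinearMap.flip_apply, innerSL_apply_apply,
      Complex.ofRealCLM_apply, smul_eq_mul, real_inner_self_eq_norm_sq, he, real_inner_comm y e]
    simp only [nsmul_eq_mul, Nat.cast_ofNat]
    push_cast
    ring
  have hint := ((integrable_chirp_mul y e g t).const_mul
    (2 * Real.pi * Complex.I * ((inner ℝ y e : ℝ) - t ^ 2) : ℂ)).sub
    ((integrable_chirp_mul y e (mulCoord e g) t).const_mul (8 * Real.pi ^ 2 * Complex.I * t : ℂ))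
  have hparts := integral_mul_fderiv_eq_neg_fderiv_mul_of_integrable (μ := volume)
    (f := fun ξ => Complex.exp (Complex.I * chirp y e t ξ)) (g := g) (v := e)
    (hint.congr (ae_of_all _ fun ξ => (hval ξ).symm))
    (integrable_chirp_mul y e (∂_{e} g) t) (integrable_chirp_mul y e g t)
    (fun ξ _ => (hexp ξ).differentiableAt) (fun ξ _ => g.differentiableAt)
  have hleft : chirpIntegral y e (∂_{e} g) t =
      ∫ ξ, Complex.exp (Complex.I * chirp y e t ξ) * fderiv ℝ g ξ e := rfl
  rw [hleft, hparts]
  simp only [hval]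
  rw [integral_sub ((integrable_chirp_mul y e g t).const_mul _)
    ((integrable_chirp_mul y e (mulCoord e g) t).const_mul _), integral_const_mul,
    integral_const_mul]
  simp only [chirpIntegral]
  ring

theorem hasDerivAt_chirpIntegral (y e : V) (g : 𝓢(V, ℂ)) (t : ℝ) :
    HasDerivAt (chirpIntegral y e g)
      (-(4 * Real.pi ^ 2 * Complex.I) * chirpIntegral y e (mulNormSq g) t
        - 4 * Real.pi * Complex.I * t * chirpIntegral y e (mulCoord e g) t) t := by
  have hexp : ∀ (s : ℝ) (ξ : V), HasDerivAt
      (fun s : ℝ => Complex.exp (Complex.I * chirp y e s ξ) * g ξ)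
      (-(4 * Real.pi ^ 2 * Complex.I) * (Complex.exp (Complex.I * chirp y e s ξ) * mulNormSq g ξ)
        - 4 * Real.pi * Complex.I * s *
          (Complex.exp (Complex.I * chirp y e s ξ) * mulCoord e g ξ)) s := by
    intro s ξ
    have h1 : HasDerivAt (fun s : ℝ => chirp y e s ξ)
        (-(4 * Real.pi ^ 2 * ‖ξ‖ ^ 2) - 4 * Real.pi * s * inner ℝ ξ e) s := by
      have h2 := (((hasDerivAt_const s (2 * Real.pi * inner ℝ ξ y)).sub
        (((hasDerivAt_id s).const_mul (4 * Real.pi ^ 2)).mul_const (‖ξ‖ ^ 2))).sub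
        (((hasDerivAt_pow 2 s).const_mul (2 * Real.pi)).mul_const (inner ℝ ξ e)))
      refine h2.congr_deriv ?_
      rw [show 2 - 1 = 1 from rfl]
      push_cast
      ring
    have h3 := ((h1.ofReal_comp.const_mul Complex.I).cexp).mul_const (g ξ)
    refine h3.congr_deriv ?_
    rw [mulNormSq_apply, mulCoord_apply]
    push_cast
    ring
  have hbound : ∀ ξ : V, ∀ s ∈ Metric.ball t 1,
      ‖-(4 * Real.pi ^ 2 * Complex.I) *
          (Complex.exp (Complex.I * chirp y e s ξ) * mulNormSq g ξ)
        - 4 * Real.pi * Complex.I * s *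
          (Complex.exp (Complex.I * chirp y e s ξ) * mulCoord e g ξ)‖ ≤
      4 * Real.pi ^ 2 * ‖mulNormSq g ξ‖ + 4 * Real.pi * (|t| + 1) * ‖mulCoord e g ξ‖ := by
    intro ξ s hs
    have hs' : |s| ≤ |t| + 1 := by
      have h1 : |s - t| < 1 := by simpa [Real.dist_eq] using hs
      have h2 := abs_add_le (s - t) t
      rw [sub_add_cancel] at h2
      linarith
    refine (norm_sub_le _ _).trans (add_le_add (le_of_eq ?_) ?_)
    · rw [norm_mul, norm_mul (Complex.exp _), mul_comm Complex.I (chirp y e s ξ : ℂ),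
        Complex.norm_exp_ofReal_mul_I, one_mul]
      simp [abs_of_pos Real.pi_pos]
    · rw [norm_mul, norm_mul (Complex.exp _), mul_comm Complex.I (chirp y e s ξ : ℂ),
        Complex.norm_exp_ofReal_mul_I, one_mul]
      refine mul_le_mul_of_nonneg_right ?_ (norm_nonneg _)
      simp only [norm_mul, Complex.norm_ofNat, Complex.norm_real, Real.norm_eq_abs,
        abs_of_pos Real.pi_pos, Complex.norm_I, mul_one]
      exact mul_le_mul_of_nonneg_left hs' (by positivity)
  have hF' : ∀ s : ℝ, Integrable fun ξ => -(4 * Real.pi ^ 2 * Complex.I) *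
          (Complex.exp (Complex.I * chirp y e s ξ) * mulNormSq g ξ)
        - 4 * Real.pi * Complex.I * s *
          (Complex.exp (Complex.I * chirp y e s ξ) * mulCoord e g ξ) := fun s =>
    ((integrable_chirp_mul y e (mulNormSq g) s).const_mul _).sub
      ((integrable_chirp_mul y e (mulCoord e g) s).const_mul _)
  have h := (hasDerivAt_integral_of_dominated_loc_of_deriv_le (μ := volume)
    (F := fun (s : ℝ) ξ => Complex.exp (Complex.I * chirp y e s ξ) * g ξ)
    (Metric.ball_mem_nhds t one_pos)
    (Eventually.of_forall fun s => (integrable_chirp_mul y e g s).aestronglyMeasurable)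
    (integrable_chirp_mul y e g t) (hF' t).aestronglyMeasurable
    (ae_of_all _ hbound)
    (((mulNormSq g).integrable.norm.const_mul _).add ((mulCoord e g).integrable.norm.const_mul _))
    (ae_of_all _ fun ξ s _ => hexp s ξ)).2
  refine h.congr_deriv ?_
  rw [integral_sub ((integrable_chirp_mul y e (mulNormSq g) t).const_mul _)
    ((integrable_chirp_mul y e (mulCoord e g) t).const_mul _), integral_const_mul,
    integral_const_mul]
  rfl

/-- The function `t ↦ (exp (i t (Δ + ⟪x, e⟫)) φ) y`. -/
def propagator (y e : V) (φ : 𝓢(V, ℂ)) (t : ℝ) : ℂ :=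
  Complex.exp (Complex.I * (t * inner ℝ y e - t ^ 3 / 3 : ℝ)) * chirpIntegral y e (𝓕 φ) t

theorem propagator_add (y e : V) (φ ψ : 𝓢(V, ℂ)) (t : ℝ) :
    propagator y e (φ + ψ) t = propagator y e φ t + propagator y e ψ t := by
  rw [propagator, FourierTransform.fourier_add, chirpIntegral_add, mul_add]
  rfl

theorem propagator_smul (y e : V) (c : ℂ) (φ : 𝓢(V, ℂ)) (t : ℝ) :
    propagator y e (c • φ) t = c * propagator y e φ t := by
  rw [propagator, FourierTransform.fourier_smul, chirpIntegral_smul, mul_left_comm]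
  rfl

theorem propagator_zero (y e : V) (φ : 𝓢(V, ℂ)) : propagator y e φ 0 = φ y := by
  have h : 𝓕⁻ (𝓕 φ) = φ := FourierTransform.fourierInv_fourier_eq φ
  conv_rhs => rw [← h, SchwartzMap.fourierInv_coe, Real.fourierInv_eq']
  simp [propagator, chirpIntegral, chirp, mul_comm Complex.I]

theorem hasDerivAt_propagator (y : V) {e : V} (he : ‖e‖ = 1) (φ : 𝓢(V, ℂ)) (t : ℝ) :
    HasDerivAt (propagator y e φ)
      (Complex.I * propagator y e (Δ φ + mulCoord e φ) t) t := by
  have h1 : HasDerivAt (fun t : ℝ => t * inner ℝ y e - t ^ 3 / 3) (inner ℝ y e - t ^ 2) t := by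
    refine (((hasDerivAt_id t).mul_const (inner ℝ y e)).sub
      ((hasDerivAt_pow 3 t).div_const 3)).congr_deriv ?_
    simp
  have h2 := ((h1.ofReal_comp.const_mul Complex.I).cexp).mul
    (hasDerivAt_chirpIntegral y e (𝓕 φ) t)
  refine h2.congr_deriv ?_
  have h3 := chirpIntegral_lineDerivOp y he (𝓕 φ) t
  have h4 : chirpIntegral y e (∂_{e} (𝓕 φ)) t =
      -(2 * Real.pi * Complex.I) * chirpIntegral y e (𝓕 (mulCoord e φ)) t := by
    rw [← neg_neg (∂_{e} (𝓕 φ)), ← fourier_mulCoord, ← neg_smul, chirpIntegral_smul]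
  have hpi : (Real.pi : ℂ) ≠ 0 := by exact_mod_cast Real.pi_ne_zero
  -- The t-derivatives of the scalar prefactor and of the t² shift in `chirp` add up to precisely
  -- this multiplication by ⟪x, e⟫.
  have h5 : Complex.I * chirpIntegral y e (𝓕 (mulCoord e φ)) t =
      Complex.I * ((inner ℝ y e : ℝ) - t ^ 2) * chirpIntegral y e (𝓕 φ) t
        - 4 * Real.pi * Complex.I * t * chirpIntegral y e (mulCoord e (𝓕 φ)) t := by
    rw [h4] at h3
    refine mul_left_cancel₀ (mul_ne_zero two_ne_zero hpi) ?_
    linear_combination -h3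
  rw [propagator_add, propagator, propagator, fourier_laplacian, chirpIntegral_smul]
  push_cast at h5 ⊢
  linear_combination (-Complex.exp (Complex.I * (t * inner ℝ y e - t ^ 3 / 3))) * h5

theorem continuous_propagator (y : V) {e : V} (he : ‖e‖ = 1) (φ : 𝓢(V, ℂ)) :
    Continuous (propagator y e φ) :=
  continuous_iff_continuousAt.2 fun t => (hasDerivAt_propagator y he φ t).continuousAt

end Propagator

section CausalSolution

open FourierTransform LineDeriv Laplacian

variable {V : Type*} [NormedAddCommGroup V] [InnerProductSpace ℝ V]
  [FiniteDimensional ℝ V] [MeasurableSpace V] [BorelSpace V]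

/-! ### Decay of the propagator in time -/

/-- The part of the conjugated position operator that is constant in time. -/
def decayConst (y e : V) : 𝓢(V, ℂ) →L[ℂ] 𝓢(V, ℂ) :=
  (2 * Real.pi * Complex.I : ℂ)⁻¹ • lineDerivOpCLM ℂ 𝓢(V, ℂ) e +
    ((inner ℝ y e : ℝ) : ℂ) • ContinuousLinearMap.id ℂ 𝓢(V, ℂ)

/-- The part of the conjugated position operator that is linear in time. -/
def decayLin (e : V) : 𝓢(V, ℂ) →L[ℂ] 𝓢(V, ℂ) :=
  (-(4 * Real.pi) : ℂ) • mulCoord e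

/-- Integration by parts in the direction e, solved for its t² term. Each use gains t² at the price
of a term linear in t, hence a net factor 1/t. -/
theorem sq_mul_chirpIntegral (y : V) {e : V} (he : ‖e‖ = 1) (g : 𝓢(V, ℂ)) (t : ℝ) :
    (t : ℂ) ^ 2 * chirpIntegral y e g t =
      chirpIntegral y e (decayConst y e g) t + t * chirpIntegral y e (decayLin e g) t := by
  have h1 : decayConst y e g =
      (2 * Real.pi * Complex.I : ℂ)⁻¹ • ∂_{e} g + ((inner ℝ y e : ℝ) : ℂ) • g := rfl
  have h2 : decayLin e g = (-(4 * Real.pi) : ℂ) • mulCoord e g := rfl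
  have hpi : (Real.pi : ℂ) ≠ 0 := by exact_mod_cast Real.pi_ne_zero
  rw [h1, h2, chirpIntegral_add, chirpIntegral_smul, chirpIntegral_smul, chirpIntegral_smul,
    chirpIntegral_lineDerivOp y he g t]
  field_simp [Complex.I_ne_zero]
  ring

/-- The constant in the decay estimate of the propagator. -/
def decayBound (y e : V) (g : 𝓢(V, ℂ)) : ℝ :=
  ‖g.toLp 1‖ + ‖(decayConst y e (decayConst y e g)).toLp 1‖
    + ‖(decayLin e (decayConst y e g)).toLp 1‖ + ‖(decayConst y e (decayLin e g)).toLp 1‖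
    + ‖(decayLin e (decayLin e g)).toLp 1‖

theorem continuous_decayBound (y e : V) : Continuous (decayBound y e) := by
  have h : Continuous fun g : 𝓢(V, ℂ) => ‖g.toLp 1‖ := (continuous_toLp).norm
  have h1 := (decayConst y e).continuous
  have h2 := (decayLin e).continuous
  exact ((((h.add (h.comp (h1.comp h1))).add (h.comp (h2.comp h1))).add
    (h.comp (h1.comp h2))).add (h.comp (h2.comp h2)))

theorem decayBound_zero (y e : V) : decayBound y e 0 = 0 := by
  have h : ‖(0 : 𝓢(V, ℂ)).toLp 1‖ = 0 := by
    rw [norm_toLp_one]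
    simp
  simp only [decayBound, map_zero, h, add_zero]

/-- Two rounds of `sq_mul_chirpIntegral` for t ≥ 1, and the trivial L¹ bound for t ≤ 1. The
dispersive bound t^{-n/2} would not do: it is never integrable on all of (0, ∞). -/
theorem norm_chirpIntegral_le_decay (y : V) {e : V} (he : ‖e‖ = 1) (g : 𝓢(V, ℂ)) {t : ℝ}
    (ht : 0 ≤ t) : ‖chirpIntegral y e g t‖ ≤ 2 * decayBound y e g * (1 + t ^ 2)⁻¹ := by
  rw [← div_eq_mul_inv, le_div_iff₀ (by positivity)]
  set N := fun g : 𝓢(V, ℂ) => ‖g.toLp 1‖ with hN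
  have hb : ∀ g : 𝓢(V, ℂ), ‖chirpIntegral y e g t‖ ≤ N g := fun g => norm_chirpIntegral_le y e g t
  have hN0 : ∀ g, 0 ≤ N g := fun g => norm_nonneg _
  have hstep : ∀ g : 𝓢(V, ℂ), t ^ 2 * ‖chirpIntegral y e g t‖ ≤
      ‖chirpIntegral y e (decayConst y e g) t‖ + t * ‖chirpIntegral y e (decayLin e g) t‖ := by
    intro g
    have h1 : t ^ 2 * ‖chirpIntegral y e g t‖ = ‖(t : ℂ) ^ 2 * chirpIntegral y e g t‖ := by
      rw [norm_mul, norm_pow, Complex.norm_real, Real.norm_eq_abs, sq_abs]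
    rw [h1, sq_mul_chirpIntegral y he]
    refine (norm_add_le _ _).trans (add_le_add le_rfl (le_of_eq ?_))
    rw [norm_mul, Complex.norm_real, Real.norm_eq_abs, abs_of_nonneg ht]
  have hP : decayBound y e g = N g + N (decayConst y e (decayConst y e g))
    + N (decayLin e (decayConst y e g)) + N (decayConst y e (decayLin e g))
    + N (decayLin e (decayLin e g)) := rfl
  have n1 := hN0 g
  have n2 := hN0 (decayConst y e (decayConst y e g))
  have n3 := hN0 (decayLin e (decayConst y e g))
  have n4 := hN0 (decayConst y e (decayLin e g))
  have n5 := hN0 (decayLin e (decayLin e g))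
  rcases le_total t 1 with h1 | h1
  · have h2 : ‖chirpIntegral y e g t‖ * (1 + t ^ 2) ≤ N g * 2 :=
      mul_le_mul (hb g) (by nlinarith) (by positivity) n1
    linarith
  · have h2 : t ^ 2 * (t ^ 2 * ‖chirpIntegral y e g t‖) ≤
        t ^ 2 * (N (decayConst y e (decayConst y e g)) + N (decayLin e (decayConst y e g))
          + N (decayConst y e (decayLin e g)) + N (decayLin e (decayLin e g))) := by
      calc t ^ 2 * (t ^ 2 * ‖chirpIntegral y e g t‖)
          ≤ t ^ 2 * (‖chirpIntegral y e (decayConst y e g) t‖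
              + t * ‖chirpIntegral y e (decayLin e g) t‖) :=
            mul_le_mul_of_nonneg_left (hstep g) (by positivity)
        _ = t ^ 2 * ‖chirpIntegral y e (decayConst y e g) t‖
              + t * (t ^ 2 * ‖chirpIntegral y e (decayLin e g) t‖) := by ring
        _ ≤ (N (decayConst y e (decayConst y e g)) + t * N (decayLin e (decayConst y e g)))
              + t * (N (decayConst y e (decayLin e g)) + t * N (decayLin e (decayLin e g))) := by
            refine add_le_add ((hstep _).trans ?_)
              (mul_le_mul_of_nonneg_left ((hstep _).trans ?_) ht)
            · exact add_le_add (hb _) (mul_le_mul_of_nonneg_left (hb _) ht)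
            · exact add_le_add (hb _) (mul_le_mul_of_nonneg_left (hb _) ht)
        _ ≤ _ := by
            have h3 : t ≤ t ^ 2 := by nlinarith
            have h4 : 1 ≤ t ^ 2 := by nlinarith
            nlinarith [mul_le_mul_of_nonneg_right h4 n2, mul_le_mul_of_nonneg_right h3 n3,
              mul_le_mul_of_nonneg_right h3 n4]
    have h3 := le_of_mul_le_mul_left h2 (by positivity : 0 < t ^ 2)
    have h4 : ‖chirpIntegral y e g t‖ ≤ t ^ 2 * ‖chirpIntegral y e g t‖ :=
      le_mul_of_one_le_left (norm_nonneg _) (by nlinarith)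
    rw [hP]
    linarith

theorem norm_propagator_le (y : V) {e : V} (he : ‖e‖ = 1) (φ : 𝓢(V, ℂ)) {t : ℝ}
    (ht : 0 ≤ t) : ‖propagator y e φ t‖ ≤ 2 * decayBound y e (𝓕 φ) * (1 + t ^ 2)⁻¹ := by
  rw [propagator, norm_mul, mul_comm Complex.I, Complex.norm_exp_ofReal_mul_I, one_mul]
  exact norm_chirpIntegral_le_decay y he _ ht

theorem integrableOn_propagator (y : V) {e : V} (he : ‖e‖ = 1) (φ : 𝓢(V, ℂ)) :
    IntegrableOn (propagator y e φ) (Set.Ioi 0) := by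
  refine Integrable.mono' ((integrable_inv_one_add_sq.const_mul
    (2 * decayBound y e (𝓕 φ))).integrableOn (s := Set.Ioi 0))
    (continuous_propagator y he φ).aestronglyMeasurable ?_
  filter_upwards [ae_restrict_mem measurableSet_Ioi] with t ht
  exact norm_propagator_le y he φ (le_of_lt ht)

theorem norm_energyPhase (E t : ℝ) : ‖Complex.exp (Complex.I * E * t)‖ = 1 := by
  rw [show Complex.I * E * t = ((E * t : ℝ) : ℂ) * Complex.I by push_cast; ring,
    Complex.norm_exp_ofReal_mul_I]

theorem integrableOn_energyPhase_mul {f : ℝ → ℂ} {s : Set ℝ} (E : ℝ) (hf : IntegrableOn f s) :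
    IntegrableOn (fun t : ℝ => Complex.exp (Complex.I * E * t) * f t) s := by
  refine hf.norm.mono' ((Continuous.aestronglyMeasurable (by fun_prop)).mul
    hf.aestronglyMeasurable) (ae_of_all _ fun t => ?_)
  rw [norm_mul, norm_energyPhase, one_mul]

/-! ### The causal solution -/

/-- The outgoing resolvent `i ∫₀^∞ exp (i E t) (exp (i t (Δ + ⟪x, e⟫)) φ) y dt`. -/
def causalPairing (y e : V) (E : ℝ) (φ : 𝓢(V, ℂ)) : ℂ :=
  Complex.I * ∫ t in Set.Ioi (0 : ℝ), Complex.exp (Complex.I * E * t) * propagator y e φ t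

theorem norm_causalPairing_le (y : V) {e : V} (he : ‖e‖ = 1) (E : ℝ) (φ : 𝓢(V, ℂ)) :
    ‖causalPairing y e E φ‖ ≤
      2 * decayBound y e (𝓕 φ) * ∫ t in Set.Ioi (0 : ℝ), (1 + t ^ 2)⁻¹ := by
  rw [causalPairing, norm_mul, Complex.norm_I, one_mul, ← integral_const_mul]
  refine norm_integral_le_of_norm_le (integrable_inv_one_add_sq.const_mul _).integrableOn ?_
  filter_upwards [ae_restrict_mem measurableSet_Ioi] with t ht
  rw [norm_mul, norm_energyPhase, one_mul]
  exact norm_propagator_le y he φ (le_of_lt ht)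

/-- The outgoing resolvent as a linear map. -/
def causalLM (y : V) {e : V} (he : ‖e‖ = 1) (E : ℝ) : 𝓢(V, ℂ) →ₗ[ℂ] ℂ where
  toFun := causalPairing y e E
  map_add' φ ψ := by
    simp only [causalPairing, propagator_add, mul_add]
    rw [integral_add (integrableOn_energyPhase_mul E (integrableOn_propagator y he φ))
      (integrableOn_energyPhase_mul E (integrableOn_propagator y he ψ)), mul_add]
  map_smul' c φ := by
    simp only [causalPairing, propagator_smul, RingHom.id_apply, smul_eq_mul]
    rw [mul_left_comm c, ← integral_const_mul c]
    congr 2 with t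
    ring

/-- The bound is a sum of L¹ norms of images under continuous operators, so it is continuous and
vanishes at 0; linearity does the rest. -/
theorem continuous_causalLM (y : V) {e : V} (he : ‖e‖ = 1) (E : ℝ) :
    Continuous (causalLM y he E) := by
  refine continuous_of_continuousAt_zero (causalLM y he E) ?_
  rw [ContinuousAt, map_zero]
  have hc : Continuous fun φ : 𝓢(V, ℂ) =>
      2 * decayBound y e (𝓕 φ) * ∫ t in Set.Ioi (0 : ℝ), (1 + t ^ 2)⁻¹ :=
    (((continuous_decayBound y e).comp (fourierCLM ℂ 𝓢(V, ℂ)).continuous).const_mul 2).mul_const _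
  have h0 := hc.tendsto 0
  rw [show 𝓕 (0 : 𝓢(V, ℂ)) = 0 from map_zero (fourierCLM ℂ 𝓢(V, ℂ)), decayBound_zero, mul_zero,
    zero_mul] at h0
  exact squeeze_zero_norm (fun φ => norm_causalPairing_le y he E φ) h0

/-- The outgoing resolvent as a tempered distribution. -/
def causalSolution (y : V) {e : V} (he : ‖e‖ = 1) (E : ℝ) : 𝓢'(V, ℂ) :=
  ContinuousLinearMap.toPointwiseConvergenceCLM ℂ (RingHom.id ℂ) 𝓢(V, ℂ) ℂ
    ⟨causalLM y he E, continuous_causalLM y he E⟩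

theorem causalSolution_apply (y : V) {e : V} (he : ‖e‖ = 1) (E : ℝ) (φ : 𝓢(V, ℂ)) :
    causalSolution y he E φ = causalPairing y e E φ := rfl

theorem tendsto_propagator_atTop (y : V) {e : V} (he : ‖e‖ = 1) (φ : 𝓢(V, ℂ)) :
    Tendsto (propagator y e φ) atTop (𝓝 0) := by
  have h : Tendsto (fun t : ℝ => 2 * decayBound y e (𝓕 φ) * (1 + t ^ 2)⁻¹) atTop (𝓝 0) := by
    rw [← mul_zero (2 * decayBound y e (𝓕 φ))]
    refine Tendsto.const_mul _ (tendsto_inv_atTop_zero.comp ?_)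
    exact tendsto_atTop_add_const_left _ _ (tendsto_pow_atTop two_ne_zero)
  refine squeeze_zero_norm' ?_ h
  filter_upwards [eventually_ge_atTop (0 : ℝ)] with t ht
  exact norm_propagator_le y he φ ht

/-- Integrate the t-derivative of e^{iEt} e^{itH} φ(y) over (0, ∞): the boundary value is φ(y) at t
= 0 and zero at infinity. -/
theorem causalPairing_stark (y : V) {e : V} (he : ‖e‖ = 1) (E : ℝ) (φ : 𝓢(V, ℂ)) :
    causalPairing y e E (Δ φ + mulCoord e φ) + E * causalPairing y e E φ = -φ y := by
  have hderiv : ∀ t : ℝ, HasDerivAt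
      (fun t : ℝ => Complex.exp (Complex.I * E * t) * propagator y e φ t)
      (Complex.I * (Complex.exp (Complex.I * E * t) * propagator y e (Δ φ + mulCoord e φ) t)
        + Complex.I * E * (Complex.exp (Complex.I * E * t) * propagator y e φ t)) t := by
    intro t
    have h1 : HasDerivAt (fun t : ℝ => Complex.I * E * (t : ℂ)) (Complex.I * E) t := by
      simpa using (Complex.ofRealCLM.hasDerivAt (x := t)).const_mul (Complex.I * E)
    refine (h1.cexp.mul (hasDerivAt_propagator y he φ t)).congr_deriv ?_
    ring
  have i1 := (integrableOn_energyPhase_mul E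
    (integrableOn_propagator y he (Δ φ + mulCoord e φ))).const_mul Complex.I
  have i2 := (integrableOn_energyPhase_mul E
    (integrableOn_propagator y he φ)).const_mul (Complex.I * E)
  have hlim : Tendsto (fun t : ℝ => Complex.exp (Complex.I * E * t) * propagator y e φ t)
      atTop (𝓝 0) := by
    have h := (tendsto_propagator_atTop y he φ).norm
    rw [norm_zero] at h
    refine squeeze_zero_norm (fun t => ?_) h
    rw [norm_mul, norm_energyPhase, one_mul]
  have key := integral_Ioi_of_hasDerivAt_of_tendsto (hderiv 0).continuousAt.continuousWithinAt
    (fun t _ => hderiv t) (i1.add i2) hlim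
  rw [integral_add i1 i2, integral_const_mul, integral_const_mul, propagator_zero] at key
  simp only [Complex.ofReal_zero, mul_zero, Complex.exp_zero, one_mul, zero_sub] at key
  rw [← key, causalPairing, causalPairing]
  ring

theorem continuous_causalPairing (y : V) {e : V} (he : ‖e‖ = 1) (φ : 𝓢(V, ℂ)) :
    Continuous fun E : ℝ => causalPairing y e E φ := by
  refine Continuous.const_mul ?_ Complex.I
  refine continuous_of_dominated (bound := fun t => ‖propagator y e φ t‖)
    (fun E => (integrableOn_energyPhase_mul E
      (integrableOn_propagator y he φ)).aestronglyMeasurable)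
    (fun E => ae_of_all _ fun t => ?_) (integrableOn_propagator y he φ).norm
    (ae_of_all _ fun t => by fun_prop)
  rw [norm_mul, norm_energyPhase, one_mul]

/-! ### The transform from energy to time -/

/-- The time-to-energy transform of a test function. -/
theorem integral_energyPhase_eq_fourier (χ : 𝓢(ℝ, ℂ)) (E : ℝ) :
    ∫ t : ℝ, χ t * Complex.exp (-(Complex.I * (E : ℂ) * (t : ℂ))) =
      𝓕 χ (E / (2 * Real.pi)) := by
  rw [SchwartzMap.fourier_coe, Real.fourier_eq']
  congr 1 with t
  rw [smul_eq_mul, mul_comm]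
  congr 2
  have hpi : (Real.pi : ℂ) ≠ 0 := by exact_mod_cast Real.pi_ne_zero
  simp only [RCLike.inner_apply, conj_trivial]
  push_cast
  field_simp

theorem integrable_fourier_energy (χ : 𝓢(ℝ, ℂ)) :
    Integrable fun E : ℝ => 𝓕 χ (E / (2 * Real.pi)) :=
  (𝓕 χ).integrable.comp_div (by positivity)

theorem integral_fourier_energy_mul_phase (χ : 𝓢(ℝ, ℂ)) (s : ℝ) :
    ∫ E : ℝ, Complex.exp (Complex.I * E * s) * 𝓕 χ (E / (2 * Real.pi)) =
      2 * Real.pi * χ s := by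
  have hpi : (Real.pi : ℂ) ≠ 0 := by exact_mod_cast Real.pi_ne_zero
  have h : 𝓕⁻ (𝓕 χ) = χ := FourierTransform.fourierInv_fourier_eq χ
  have h1 := Measure.integral_comp_div (fun η : ℝ =>
    Complex.exp (((2 * Real.pi * inner ℝ η s : ℝ) : ℂ) * Complex.I) • 𝓕 χ η) (2 * Real.pi)
  rw [abs_of_pos (by positivity), ← Real.fourierInv_eq', ← SchwartzMap.fourierInv_coe, h] at h1
  rw [Complex.real_smul] at h1
  push_cast at h1
  rw [← h1]
  congr 1 with E
  rw [smul_eq_mul]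
  congr 2
  simp only [RCLike.inner_apply, conj_trivial]
  push_cast
  field_simp

/-- After Fubini the energy integral returns 2πχ(t) by Fourier inversion, and only times t > 0,
where χ vanishes, are integrated over. -/
theorem timeTransform_causalPairing (y : V) {e : V} (he : ‖e‖ = 1) (φ : 𝓢(V, ℂ))
    {χ : 𝓢(ℝ, ℂ)} (hχ : tsupport χ ⊆ Set.Iio 0) :
    timeTransform (fun E => causalPairing y e E φ) χ = 0 := by
  have hint : Integrable (fun p : ℝ × ℝ => Complex.exp (Complex.I * p.1 * p.2) *
      (𝓕 χ (p.1 / (2 * Real.pi)) * propagator y e φ p.2))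
      (volume.prod (volume.restrict (Set.Ioi 0))) := by
    have h := (integrable_fourier_energy χ).mul_prod (integrableOn_propagator y he φ)
    refine h.norm.mono' ((Continuous.aestronglyMeasurable (by fun_prop)).mul
      h.aestronglyMeasurable) (ae_of_all _ fun p => ?_)
    rw [norm_mul, norm_energyPhase, one_mul]
  have h1 : ∀ E : ℝ, causalPairing y e E φ *
      ∫ t : ℝ, χ t * Complex.exp (-(Complex.I * (E : ℂ) * (t : ℂ))) =
      Complex.I * ∫ t in Set.Ioi (0 : ℝ), Complex.exp (Complex.I * E * t) *
        (𝓕 χ (E / (2 * Real.pi)) * propagator y e φ t) := by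
    intro E
    rw [integral_energyPhase_eq_fourier, causalPairing, mul_assoc, ← integral_mul_const]
    congr 2 with t
    ring
  rw [timeTransform]
  simp only [h1]
  rw [integral_const_mul, integral_integral_swap hint]
  have h2 : ∀ t ∈ Set.Ioi (0 : ℝ), ∫ E : ℝ, Complex.exp (Complex.I * E * t) *
        (𝓕 χ (E / (2 * Real.pi)) * propagator y e φ t) = 0 := by
    intro t ht
    simp only [← mul_assoc]
    rw [integral_mul_const, integral_fourier_energy_mul_phase,
      image_eq_zero_of_notMem_tsupport fun h =>
        lt_asymm (Set.mem_Iio.1 (hχ h)) (Set.mem_Ioi.1 ht)]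
    simp
  rw [setIntegral_congr_fun measurableSet_Ioi h2]
  simp

end CausalSolution

section FreeKernel

open FourierTransform LineDeriv Laplacian

variable {V : Type*} [NormedAddCommGroup V] [InnerProductSpace ℝ V]

/-! ### The propagator in position space -/

theorem norm_cexp_neg_div_le {c : ℂ} (hc : 0 ≤ c.re) {r : ℝ} (hr : 0 ≤ r) :
    ‖Complex.exp (-(r : ℂ) / (4 * c))‖ ≤ 1 := by
  rw [Complex.norm_exp, Real.exp_le_one_iff]
  have h : (-(r : ℂ) / (4 * c)).re = -(r * c.re / (4 * Complex.normSq c)) := by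
    rw [Complex.div_re]
    simp only [Complex.neg_re, Complex.neg_im, Complex.ofReal_re, Complex.ofReal_im, Complex.mul_re,
      Complex.mul_im, Complex.re_ofNat, Complex.im_ofNat, Complex.normSq_mul,
      Complex.normSq_ofNat]
    by_cases h0 : Complex.normSq c = 0
    · simp [h0]
    · field_simp
      ring
  rw [h, neg_nonpos]
  have := Complex.normSq_nonneg c
  positivity

variable [FiniteDimensional ℝ V] [MeasurableSpace V] [BorelSpace V]

/-- The Gaussian factor replaces the imaginary time it by ε + it. The chirp is then integrable, and
the Fourier transform can be moved from φ onto it. -/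
theorem integral_gaussian_chirp_mul_fourier (y e : V) (φ : 𝓢(V, ℂ)) (t : ℝ) {ε : ℝ} (hε : 0 < ε) :
    ∫ ξ, (Real.exp (-(4 * Real.pi ^ 2 * ε * ‖ξ‖ ^ 2)) : ℂ) *
        (Complex.exp (Complex.I * chirp y e t ξ) * 𝓕 φ ξ) =
      (1 / (4 * Real.pi * (ε + t * Complex.I))) ^ (Module.finrank ℝ V / 2 : ℂ) *
        ∫ x, Complex.exp (-((‖y - t ^ 2 • e - x‖ ^ 2 : ℝ) : ℂ) / (4 * (ε + t * Complex.I))) *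
          φ x := by
  have hpi : (Real.pi : ℂ) ≠ 0 := by exact_mod_cast Real.pi_ne_zero
  set b : ℂ := 4 * Real.pi ^ 2 * (ε + t * Complex.I) with hb
  have hbre : b.re = 4 * Real.pi ^ 2 * ε := by
    rw [hb, show (4 * Real.pi ^ 2 : ℂ) = ((4 * Real.pi ^ 2 : ℝ) : ℂ) by push_cast; rfl,
      Complex.re_ofReal_mul]
    simp
  have hbpos : 0 < b.re := by rw [hbre]; positivity
  have hc0 : (ε + t * Complex.I : ℂ) ≠ 0 := by
    intro h
    have := congrArg Complex.re h
    simp at this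
    exact hε.ne' this
  set γ : V → ℂ := fun v =>
    Complex.exp (-b * ‖v‖ ^ 2 + 2 * Real.pi * Complex.I * (inner ℝ (y - t ^ 2 • e) v : ℝ)) with hγ
  have hγint : Integrable γ :=
    GaussianFourier.integrable_cexp_neg_mul_sq_norm_add hbpos (2 * Real.pi * Complex.I)
      (y - t ^ 2 • e)
  have hself : ∫ ξ, 𝓕 γ ξ * φ ξ = ∫ x, γ x * 𝓕 φ x := by
    simpa using! VectorFourier.integral_fourierIntegral_smul_eq_flip (L := innerₗ V)
      Real.continuous_fourierChar continuous_inner hγint φ.integrable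
  have hγeq : ∀ ξ, γ ξ = (Real.exp (-(4 * Real.pi ^ 2 * ε * ‖ξ‖ ^ 2)) : ℂ) *
      Complex.exp (Complex.I * chirp y e t ξ) := by
    intro ξ
    have hinner : inner ℝ (y - t ^ 2 • e) ξ = inner ℝ ξ y - t ^ 2 * inner ℝ ξ e := by
      rw [real_inner_comm, inner_sub_right, real_inner_smul_right]
    rw [Complex.ofReal_exp, ← Complex.exp_add]
    refine congrArg Complex.exp ?_
    rw [hb, chirp, hinner]
    push_cast
    ring
  rw [← integral_const_mul]
  simp only [← mul_assoc, ← hγeq]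
  rw [← hself]
  congr 1 with x
  congr 1
  rw [hγ, fourier_gaussian_innerProductSpace' hbpos]
  congr 2
  · rw [hb]
    field_simp
  · rw [hb]
    push_cast
    field_simp

/-- Let ε → 0⁺ on both sides by dominated convergence. The base of the power tends to a point of the
negative imaginary axis, off the branch cut, so the principal branch survives the limit. -/
theorem chirpIntegral_fourier (y e : V) (φ : 𝓢(V, ℂ)) {t : ℝ} (ht : 0 < t) :
    chirpIntegral y e (𝓕 φ) t =
      (1 / (4 * Real.pi * (t * Complex.I))) ^ (Module.finrank ℝ V / 2 : ℂ) *
        ∫ x, Complex.exp (-((‖y - t ^ 2 • e - x‖ ^ 2 : ℝ) : ℂ) / (4 * (t * Complex.I))) *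
          φ x := by
  have hpi : (Real.pi : ℂ) ≠ 0 := by exact_mod_cast Real.pi_ne_zero
  have htI : (t * Complex.I : ℂ) ≠ 0 :=
    mul_ne_zero (by exact_mod_cast ht.ne') Complex.I_ne_zero
  have hpos : ∀ᶠ ε : ℝ in 𝓝[>] 0, 0 < ε := eventually_mem_nhdsWithin
  have hcexp : ContinuousAt (fun ε : ℝ => (ε + t * Complex.I : ℂ)) 0 := by fun_prop
  have hleft : Tendsto (fun ε : ℝ => ∫ ξ, (Real.exp (-(4 * Real.pi ^ 2 * ε * ‖ξ‖ ^ 2)) : ℂ) *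
        (Complex.exp (Complex.I * chirp y e t ξ) * 𝓕 φ ξ)) (𝓝[>] 0)
      (𝓝 (chirpIntegral y e (𝓕 φ) t)) := by
    refine tendsto_integral_filter_of_dominated_convergence (fun ξ => ‖𝓕 φ ξ‖) ?_ ?_
      (𝓕 φ).integrable.norm (ae_of_all _ fun ξ => ?_)
    · exact Eventually.of_forall fun ε => (Continuous.aestronglyMeasurable (by fun_prop)).mul
        (integrable_chirp_mul y e (𝓕 φ) t).aestronglyMeasurable
    · filter_upwards [hpos] with ε hε
      refine ae_of_all _ fun ξ => ?_
      rw [norm_mul, norm_mul, mul_comm Complex.I, Complex.norm_exp_ofReal_mul_I, one_mul,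
        Complex.norm_real, Real.norm_eq_abs, Real.abs_exp]
      refine mul_le_of_le_one_left (norm_nonneg _) (Real.exp_le_one_iff.2 ?_)
      rw [neg_nonpos]
      positivity
    · have hc : Continuous fun ε : ℝ => (Real.exp (-(4 * Real.pi ^ 2 * ε * ‖ξ‖ ^ 2)) : ℂ) *
        (Complex.exp (Complex.I * chirp y e t ξ) * 𝓕 φ ξ) := by fun_prop
      have := (hc.tendsto 0).mono_left (nhdsWithin_le_nhds (s := Set.Ioi 0))
      simpa using this
  have hright : Tendsto (fun ε : ℝ =>
      (1 / (4 * Real.pi * (ε + t * Complex.I))) ^ (Module.finrank ℝ V / 2 : ℂ) *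
        ∫ x, Complex.exp (-((‖y - t ^ 2 • e - x‖ ^ 2 : ℝ) : ℂ) / (4 * (ε + t * Complex.I))) * φ x)
      (𝓝[>] 0) (𝓝 ((1 / (4 * Real.pi * (t * Complex.I))) ^ (Module.finrank ℝ V / 2 : ℂ) *
        ∫ x, Complex.exp (-((‖y - t ^ 2 • e - x‖ ^ 2 : ℝ) : ℂ) / (4 * (t * Complex.I))) *
          φ x)) := by
    refine Tendsto.mul ?_ (tendsto_integral_filter_of_dominated_convergence (fun x => ‖φ x‖) ?_ ?_
      φ.integrable.norm (ae_of_all _ fun x => ?_))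
    · have hslit : (1 / (4 * Real.pi * (((0 : ℝ) : ℂ) + t * Complex.I)) : ℂ) ∈
          Complex.slitPlane := by
        have h : (1 / (4 * Real.pi * (((0 : ℝ) : ℂ) + t * Complex.I)) : ℂ) =
            ((-(4 * Real.pi * t)⁻¹ : ℝ) : ℂ) * Complex.I := by
          have ht0 : (t : ℂ) ≠ 0 := by exact_mod_cast ht.ne'
          push_cast
          field_simp
          linear_combination (t : ℂ) * Complex.I_sq
        rw [Complex.mem_slitPlane_iff, h, Complex.im_ofReal_mul, Complex.I_im, mul_one]
        right
        have := Real.pi_pos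
        exact (neg_lt_zero.2 (by positivity)).ne
      have hc : ContinuousAt (fun ε : ℝ =>
          (1 / (4 * Real.pi * (ε + t * Complex.I)) : ℂ) ^ (Module.finrank ℝ V / 2 : ℂ)) 0 := by
        refine ContinuousAt.cpow ?_ continuousAt_const hslit
        refine continuousAt_const.div (continuousAt_const.mul hcexp) ?_
        simpa [hpi] using ht.ne'
      have := hc.tendsto.mono_left (nhdsWithin_le_nhds (s := Set.Ioi 0))
      simpa using this
    · exact Eventually.of_forall fun ε => (Continuous.aestronglyMeasurable (by fun_prop)).mul
        φ.integrable.aestronglyMeasurable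
    · filter_upwards [hpos] with ε hε
      refine ae_of_all _ fun x => ?_
      rw [norm_mul]
      refine mul_le_of_le_one_left (norm_nonneg _) (norm_cexp_neg_div_le ?_ (by positivity))
      simpa using hε.le
    · have hc : ContinuousAt (fun ε : ℝ =>
          Complex.exp (-((‖y - t ^ 2 • e - x‖ ^ 2 : ℝ) : ℂ) / (4 * (ε + t * Complex.I))) * φ x)
          0 := by
        refine ContinuousAt.mul (ContinuousAt.cexp ?_) continuousAt_const
        refine continuousAt_const.div (continuousAt_const.mul hcexp) ?_
        simpa using ht.ne'
      have := hc.tendsto.mono_left (nhdsWithin_le_nhds (s := Set.Ioi 0))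
      simpa using this
  refine tendsto_nhds_unique hleft (hright.congr' ?_)
  filter_upwards [hpos] with ε hε
  exact (integral_gaussian_chirp_mul_fourier y e φ t hε).symm

end FreeKernel

section PositionSpace

open FourierTransform LineDeriv Laplacian

variable {n : ℕ} [NeZero n]

/-- The upward unit vector. -/
def vertDir (n : ℕ) [NeZero n] : EuclideanSpace ℝ (Fin n) :=
  EuclideanSpace.single ⟨n - 1, Nat.sub_one_lt (NeZero.ne n)⟩ 1

theorem norm_vertDir : ‖vertDir n‖ = 1 := by
  simp [vertDir]

theorem inner_vertDir (x : EuclideanSpace ℝ (Fin n)) : inner ℝ x (vertDir n) = vert x := by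
  simp [vertDir, vert, EuclideanSpace.inner_single_right]

theorem norm_kernelIntegrand (E : ℝ) (x y : EuclideanSpace ℝ (Fin n)) (t : ℝ) :
    ‖kernelIntegrand E x y t‖ = |t ^ (-((n : ℝ) / 2))| := by
  rw [kernelIntegrand, norm_mul, mul_comm Complex.I, Complex.norm_exp_ofReal_mul_I, mul_one,
    Complex.norm_real, Real.norm_eq_abs]

/-- A positive factor splits off the principal power, and inversion commutes with it because
arg(4πi) = π/2 ≠ π. -/
theorem one_div_cpow_eq {t : ℝ} (ht : 0 < t) (s : ℝ) :
    (1 / (4 * Real.pi * (t * Complex.I))) ^ (s : ℂ) =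
      1 / (4 * Real.pi * Complex.I) ^ (s : ℂ) * ((t ^ (-s) : ℝ) : ℂ) := by
  have hpi : (Real.pi : ℂ) ≠ 0 := by exact_mod_cast Real.pi_ne_zero
  have hI : (4 * Real.pi * Complex.I : ℂ) = ((4 * Real.pi : ℝ) : ℂ) * Complex.I := by
    push_cast; rfl
  have hne : (4 * Real.pi * Complex.I : ℂ) ≠ 0 := by
    simp [hpi]
  have harg : (4 * Real.pi * Complex.I : ℂ).arg ≠ Real.pi := by
    rw [hI, Complex.arg_real_mul _ (by positivity), Complex.arg_I]
    linarith [Real.pi_pos]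
  have h1 : (1 / (4 * Real.pi * (t * Complex.I)) : ℂ) =
      ((t⁻¹ : ℝ) : ℂ) * (4 * Real.pi * Complex.I)⁻¹ := by
    push_cast
    rw [one_div, ← mul_inv]
    congr 1
    ring
  have h2 : ((t⁻¹ : ℝ) : ℂ) ^ (s : ℂ) = ((t ^ (-s) : ℝ) : ℂ) := by
    rw [← Complex.ofReal_cpow (by positivity), Real.inv_rpow ht.le, Real.rpow_neg ht.le]
  have h3 : (((t⁻¹ : ℝ) : ℂ) * (4 * Real.pi * Complex.I)⁻¹) ^ (s : ℂ) =
      ((t⁻¹ : ℝ) : ℂ) ^ (s : ℂ) * ((4 * Real.pi * Complex.I)⁻¹) ^ (s : ℂ) := by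
    have ht' : ((t⁻¹ : ℝ) : ℂ) ≠ 0 := by simpa using ht.ne'
    rw [Complex.cpow_def_of_ne_zero (mul_ne_zero ht' (inv_ne_zero hne)),
      Complex.cpow_def_of_ne_zero ht', Complex.cpow_def_of_ne_zero (inv_ne_zero hne),
      Complex.log_ofReal_mul (by positivity) (inv_ne_zero hne), Complex.ofReal_log (by positivity),
      add_mul, Complex.exp_add]
  rw [h1, h3, h2, Complex.inv_cpow _ _ harg, one_div, mul_comm]

/-- The propagator is given by the explicit kernel. -/
theorem energyPhase_mul_propagator (E : ℝ) (y : EuclideanSpace ℝ (Fin n))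
    (φ : 𝓢(EuclideanSpace ℝ (Fin n), ℂ)) {t : ℝ} (ht : 0 < t) :
    Complex.exp (Complex.I * E * t) * propagator y (vertDir n) φ t =
      1 / (4 * (Real.pi : ℂ) * Complex.I) ^ ((n : ℂ) / 2) *
        ∫ x, kernelIntegrand E x y t * φ x := by
  have hcp := one_div_cpow_eq ht ((n : ℝ) / 2)
  push_cast at hcp
  rw [propagator, chirpIntegral_fourier _ _ _ ht, finrank_euclideanSpace_fin, hcp,
    ← integral_const_mul, ← integral_const_mul, ← integral_const_mul, ← integral_const_mul]
  congr 1 with x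
  -- The square expands to |x-y|² + 2t²(xₙ-yₙ) + t⁴. Divided by 4t, its cross term changes t yₙ into
  -- t(xₙ+yₙ)/2, and t³/4 - t³/3 = -t³/12.
  have hphase : (E : ℂ) * t + ((t * inner ℝ y (vertDir n) - t ^ 3 / 3 : ℝ) : ℂ) +
      (‖y - t ^ 2 • vertDir n - x‖ ^ 2 : ℝ) / (4 * t) = (phase E x y t : ℂ) := by
    have h1 : ‖y - t ^ 2 • vertDir n - x‖ ^ 2 =
        ‖x - y‖ ^ 2 + 2 * t ^ 2 * (vert x - vert y) + t ^ 4 := by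
      have h2 : y - t ^ 2 • vertDir n - x = -((x - y) + t ^ 2 • vertDir n) := by abel
      rw [h2, norm_neg, norm_add_sq_real, real_inner_smul_right, norm_smul, norm_vertDir,
        inner_sub_left, inner_vertDir, inner_vertDir, mul_one, Real.norm_eq_abs, sq_abs]
      ring
    rw [h1, inner_vertDir, phase]
    have ht0 : (t : ℂ) ≠ 0 := by exact_mod_cast ht.ne'
    push_cast
    field_simp
    ring
  have hexp : Complex.exp (Complex.I * E * t) *
      (Complex.exp (Complex.I * (t * inner ℝ y (vertDir n) - t ^ 3 / 3 : ℝ)) *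
        Complex.exp (-((‖y - t ^ 2 • vertDir n - x‖ ^ 2 : ℝ) : ℂ) / (4 * (t * Complex.I)))) =
      Complex.exp (Complex.I * phase E x y t) := by
    rw [← Complex.exp_add, ← Complex.exp_add, ← hphase]
    congr 1
    have h3 : -((‖y - t ^ 2 • vertDir n - x‖ ^ 2 : ℝ) : ℂ) / (4 * (t * Complex.I)) =
        Complex.I * ((‖y - t ^ 2 • vertDir n - x‖ ^ 2 : ℝ) / (4 * t)) := by
      have ht0 : (t : ℂ) ≠ 0 := by exact_mod_cast ht.ne'
      field_simp
      rw [Complex.I_sq]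
      ring
    rw [h3]
    ring
  rw [kernelIntegrand, ← hexp]
  push_cast
  ring

end PositionSpace

section Representation

variable {n : ℕ} [NeZero n]

/-! ### The causal solution is the explicit kernel -/

theorem measurable_kernelIntegrand (E : ℝ) (y : EuclideanSpace ℝ (Fin n)) :
    Measurable fun p : ℝ × EuclideanSpace ℝ (Fin n) => kernelIntegrand E p.2 y p.1 := by
  have := (continuous_vert (n := n)).measurable
  unfold kernelIntegrand phase
  fun_prop

theorem norm_damped_kernelIntegrand_congr (E : ℝ) (x x' y : EuclideanSpace ℝ (Fin n))
    (a b t : ℝ) :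
    ‖damped (kernelIntegrand E x y) a b t‖ = ‖damped (kernelIntegrand E x' y) a b t‖ := by
  rw [damped, damped, norm_mul, norm_mul, norm_kernelIntegrand, norm_kernelIntegrand]

/-- The damped version of `causalPairing`, computed with the kernel. -/
theorem integral_damped_propagator (E : ℝ) (y : EuclideanSpace ℝ (Fin n))
    (φ : 𝓢(EuclideanSpace ℝ (Fin n), ℂ)) {a b : ℝ} (ha : 0 < a) (hb : 0 < b) :
    ∫ t in Set.Ioi (0 : ℝ), (Real.exp (-a / t - b * t) : ℂ) *
        (Complex.exp (Complex.I * E * t) * propagator y (vertDir n) φ t) =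
      1 / (4 * (Real.pi : ℂ) * Complex.I) ^ ((n : ℂ) / 2) *
        ∫ x, (∫ t in Set.Ioi (0 : ℝ), damped (kernelIntegrand E x y) a b t) * φ x := by
  -- Any point other than y would do: the modulus of the integrand is independent of x, so
  -- integrability in t at one point gives joint integrability.
  have hx₀ : y + vertDir n ≠ y := by
    intro h
    have h1 : vertDir n = 0 := by simpa using h
    have h2 := norm_vertDir (n := n)
    rw [h1, norm_zero] at h2
    exact zero_ne_one h2
  have hg := (integral_damped_kernelIntegrand (E := E) (Or.inl hx₀) ha hb).1
  have hint : Integrable (fun p : ℝ × EuclideanSpace ℝ (Fin n) =>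
      damped (kernelIntegrand E p.2 y) a b p.1 * φ p.2)
      ((volume.restrict (Set.Ioi 0)).prod volume) := by
    have h := hg.mul_prod (φ.integrable (μ := volume))
    refine h.norm.mono' (Measurable.aestronglyMeasurable ?_) (ae_of_all _ fun p => ?_)
    · have h1 := measurable_kernelIntegrand E y
      have h2 := φ.continuous.measurable
      unfold damped
      fun_prop
    · rw [norm_mul, norm_mul, norm_damped_kernelIntegrand_congr E p.2 (y + vertDir n)]
  have h1 : ∀ t ∈ Set.Ioi (0 : ℝ), (Real.exp (-a / t - b * t) : ℂ) *
        (Complex.exp (Complex.I * E * t) * propagator y (vertDir n) φ t) =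
      1 / (4 * (Real.pi : ℂ) * Complex.I) ^ ((n : ℂ) / 2) *
        ∫ x, damped (kernelIntegrand E x y) a b t * φ x := by
    intro t ht
    rw [energyPhase_mul_propagator E y φ ht, mul_left_comm, ← integral_const_mul]
    simp only [damped, mul_assoc]
  rw [setIntegral_congr_fun measurableSet_Ioi h1, integral_const_mul,
    integral_integral_swap hint]
  congr 2 with x
  rw [integral_mul_const]

theorem tendsto_diagonal_nhdsGT :
    Tendsto (fun ε : ℝ => (ε, ε)) (𝓝[>] 0) (𝓝[>] 0 ×ˢ 𝓝[>] 0) :=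
  tendsto_id.prodMk tendsto_id

theorem tendsto_integral_damped_propagator (E : ℝ) (y : EuclideanSpace ℝ (Fin n))
    (φ : 𝓢(EuclideanSpace ℝ (Fin n), ℂ)) :
    Tendsto (fun ε : ℝ => Complex.I * ∫ t in Set.Ioi (0 : ℝ), (Real.exp (-ε / t - ε * t) : ℂ) *
        (Complex.exp (Complex.I * E * t) * propagator y (vertDir n) φ t)) (𝓝[>] 0)
      (𝓝 (causalPairing y (vertDir n) E φ)) := by
  have hφ := integrableOn_propagator y norm_vertDir φ
  have hpos : ∀ᶠ ε : ℝ in 𝓝[>] 0, 0 < ε := eventually_mem_nhdsWithin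
  refine Tendsto.const_mul _ (tendsto_integral_filter_of_dominated_convergence
    (fun t => ‖propagator y (vertDir n) φ t‖) ?_ ?_ hφ.norm (ae_of_all _ fun t => ?_))
  · refine Eventually.of_forall fun ε => AEStronglyMeasurable.mul
      (Measurable.aestronglyMeasurable (by fun_prop))
      (integrableOn_energyPhase_mul E hφ).aestronglyMeasurable
  · filter_upwards [hpos] with ε hε
    filter_upwards [ae_restrict_mem measurableSet_Ioi] with t ht
    have ht' : 0 < t := ht
    rw [norm_mul, norm_mul, norm_energyPhase, one_mul, Complex.norm_real, Real.norm_eq_abs,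
      Real.abs_exp]
    refine mul_le_of_le_one_left (norm_nonneg _) (Real.exp_le_one_iff.2 ?_)
    have h1 : 0 ≤ ε / t := by positivity
    have h2 : 0 ≤ ε * t := by positivity
    rw [neg_div]
    linarith
  · have hc : Continuous fun ε : ℝ => (Real.exp (-ε / t - ε * t) : ℂ) *
        (Complex.exp (Complex.I * E * t) * propagator y (vertDir n) φ t) := by fun_prop
    have := (hc.tendsto 0).mono_left (nhdsWithin_le_nhds (s := Set.Ioi 0))
    simpa using this

/-- The constant e^{(C+2)³} in the domination is uniform only while the vertical coordinate is
bounded, hence the compact support of φ. -/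
theorem tendsto_integral_damped_kernel (E : ℝ) (y : EuclideanSpace ℝ (Fin n))
    {φ : 𝓢(EuclideanSpace ℝ (Fin n), ℂ)} (hφ : HasCompactSupport φ) :
    Tendsto (fun ε : ℝ =>
        ∫ x, (∫ t in Set.Ioi (0 : ℝ), damped (kernelIntegrand E x y) ε ε t) * φ x) (𝓝[>] 0)
      (𝓝 (∫ x, oscillatoryIntegral (kernelIntegrand E x y) * φ x)) := by
  have hpos : ∀ᶠ ε : ℝ in 𝓝[>] 0, 0 < ε := eventually_mem_nhdsWithin
  have hcont : Continuous fun x : EuclideanSpace ℝ (Fin n) => |(vert x + vert y) / 2 + E| := by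
    have := continuous_vert (n := n)
    fun_prop
  obtain ⟨C, hC⟩ := hφ.isCompact.bddAbove_image hcont.continuousOn
  obtain ⟨B, hB⟩ := φ.continuous.bounded_above_of_compact_support hφ
  refine tendsto_integral_filter_of_dominated_convergence
    (fun x => Real.exp ((C + 2) ^ 3) * majorant y x * B) ?_ ?_
    (((integrable_majorant y).const_mul _).mul_const B) ?_
  · refine Eventually.of_forall fun ε => AEStronglyMeasurable.mul ?_
      φ.continuous.aestronglyMeasurable
    have h1 := measurable_kernelIntegrand E y
    have h2 : Measurable fun p : EuclideanSpace ℝ (Fin n) × ℝ =>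
        damped (kernelIntegrand E p.1 y) ε ε p.2 := by
      have h3 : Measurable fun p : EuclideanSpace ℝ (Fin n) × ℝ => kernelIntegrand E p.1 y p.2 :=
        h1.comp measurable_swap
      unfold damped
      fun_prop
    exact (h2.stronglyMeasurable.integral_prod_right' (ν := volume.restrict (Set.Ioi 0))
      ).aestronglyMeasurable
  · filter_upwards [hpos] with ε hε
    filter_upwards [ae_ne y] with x hx
    rw [norm_mul]
    have hB0 : 0 ≤ B := (norm_nonneg _).trans (hB x)
    have hmaj : 0 ≤ majorant y x := integral_nonneg fun u => (Real.exp_pos _).le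
    by_cases hxs : x ∈ tsupport φ
    · rw [(integral_damped_kernelIntegrand (Or.inl hx) hε hε).2]
      exact mul_le_mul (norm_rotatedIntegral_coeff_le hx hε.le hε.le (hC ⟨x, hxs, rfl⟩)) (hB x)
        (norm_nonneg _) (by positivity)
    · rw [image_eq_zero_of_notMem_tsupport hxs, norm_zero, mul_zero]
      positivity
  · filter_upwards [ae_ne y] with x hx
    have h := hasOscillatoryIntegral_kernelIntegrand E (Or.inl hx)
    have h' := h.2.comp tendsto_diagonal_nhdsGT
    rw [← h.eq] at h'
    exact h'.mul_const _

/-- Both sides are limits, along a = b = ε, of the same damped double integral. The damping is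
needed for Fubini since the undamped integrand has modulus t^{-n/2}, not integrable on (0, ∞). -/
theorem causalPairing_eq_integral_kernel (E : ℝ) (y : EuclideanSpace ℝ (Fin n))
    {φ : 𝓢(EuclideanSpace ℝ (Fin n), ℂ)} (hφ : HasCompactSupport φ) :
    causalPairing y (vertDir n) E φ = ∫ x, kernel E x y * φ x := by
  refine tendsto_nhds_unique (tendsto_integral_damped_propagator E y φ) ?_
  have h1 := (tendsto_integral_damped_kernel E y hφ).const_mul
    (Complex.I / (4 * (Real.pi : ℂ) * Complex.I) ^ ((n : ℂ) / 2))
  have h2 : ∫ x, kernel E x y * φ x =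
      Complex.I / (4 * (Real.pi : ℂ) * Complex.I) ^ ((n : ℂ) / 2) *
        ∫ x, oscillatoryIntegral (kernelIntegrand E x y) * φ x := by
    rw [← integral_const_mul]
    simp only [kernel, mul_assoc]
  rw [h2]
  refine h1.congr' ?_
  have hpos : ∀ᶠ ε : ℝ in 𝓝[>] 0, 0 < ε := eventually_mem_nhdsWithin
  filter_upwards [hpos] with ε hε
  rw [integral_damped_propagator E y φ hε hε]
  ring

end Representation

/-! ### The Stark Hamiltonian is conjugate to a multiplication operator -/

section DividedDifference

/-- The divided difference `(exp (i z) - 1) / (i z)`, and its derivatives. -/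
def expDividedDiff (k : ℕ) (z : ℝ) : ℂ :=
  ∫ τ in (0 : ℝ)..1, (Complex.I * τ) ^ k * Complex.exp (Complex.I * τ * z)

theorem norm_pow_mul_cexp_le (k : ℕ) {τ : ℝ} (hτ : τ ∈ Set.uIoc (0 : ℝ) 1) (z : ℝ) :
    ‖(Complex.I * τ) ^ k * Complex.exp (Complex.I * τ * z)‖ ≤ 1 := by
  rw [Set.uIoc_of_le zero_le_one] at hτ
  rw [norm_mul, norm_energyPhase, mul_one, norm_pow, norm_mul, Complex.norm_I, one_mul,
    Complex.norm_real, Real.norm_eq_abs, abs_of_pos hτ.1]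
  exact pow_le_one₀ hτ.1.le hτ.2

theorem hasTemperateGrowth_expDividedDiff : (expDividedDiff 0).HasTemperateGrowth := by
  refine hasTemperateGrowth_of_hasDerivAt (fun k z => ?_) (fun k => ⟨1, fun z => ?_⟩) 0
  · refine (intervalIntegral.hasDerivAt_integral_of_dominated_loc_of_deriv_le
      (𝕜 := ℝ) (x₀ := z) (s := Set.univ)
      (F := fun (z τ : ℝ) => (Complex.I * τ) ^ k * Complex.exp (Complex.I * τ * z))
      (F' := fun (z τ : ℝ) => (Complex.I * τ) ^ (k + 1) * Complex.exp (Complex.I * τ * z))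
      (bound := fun _ => 1) univ_mem
      (Eventually.of_forall fun z => Continuous.aestronglyMeasurable (by fun_prop))
      (Continuous.intervalIntegrable (by fun_prop) _ _)
      (Continuous.aestronglyMeasurable (by fun_prop))
      (ae_of_all _ fun τ hτ z _ => norm_pow_mul_cexp_le (k + 1) hτ z)
      intervalIntegrable_const (ae_of_all _ fun τ _ z _ => ?_)).2
    have h1 : HasDerivAt (fun z : ℝ => Complex.I * τ * (z : ℂ)) (Complex.I * τ) z := by
      simpa using (Complex.ofRealCLM.hasDerivAt (x := z)).const_mul (Complex.I * τ)
    refine (h1.cexp.const_mul _).congr_deriv ?_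
    ring
  · refine (intervalIntegral.norm_integral_le_of_norm_le_const fun τ hτ =>
      norm_pow_mul_cexp_le k hτ z).trans ?_
    simp

theorem mul_expDividedDiff (z : ℝ) :
    Complex.I * z * expDividedDiff 0 z = Complex.exp (Complex.I * z) - 1 := by
  have h : ∀ τ ∈ Set.uIcc (0 : ℝ) 1, HasDerivAt (fun τ : ℝ => Complex.exp (Complex.I * τ * z))
      (Complex.I * z * Complex.exp (Complex.I * τ * z)) τ := by
    intro τ _
    have h1 : HasDerivAt (fun τ : ℝ => Complex.I * (τ : ℂ) * z) (Complex.I * z) τ := by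
      simpa using ((Complex.ofRealCLM.hasDerivAt (x := τ)).const_mul Complex.I).mul_const (z : ℂ)
    refine h1.cexp.congr_deriv ?_
    ring
  have h2 := intervalIntegral.integral_eq_sub_of_hasDerivAt h
    (Continuous.intervalIntegrable (by fun_prop) _ _)
  rw [intervalIntegral.integral_const_mul] at h2
  simpa [expDividedDiff] using h2

end DividedDifference

/-! ### The Stark evolution on Schwartz functions and its action on solutions. -/

section Conjugation

open FourierTransform LineDeriv Laplacian

variable {V : Type*} [NormedAddCommGroup V] [InnerProductSpace ℝ V]

/-- Multiplication by `exp (i p)`. -/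
def mulExpI (p : V → ℝ) : 𝓢(V, ℂ) →L[ℂ] 𝓢(V, ℂ) :=
  SchwartzMap.smulLeftCLM ℂ fun ξ => Complex.exp (Complex.I * p ξ)

theorem mulExpI_apply {p : V → ℝ} (hp : p.HasTemperateGrowth) (g : 𝓢(V, ℂ)) (ξ : V) :
    mulExpI p g ξ = Complex.exp (Complex.I * p ξ) * g ξ := by
  rw [mulExpI, smulLeftCLM_apply_apply (hasTemperateGrowth_expI hp), smul_eq_mul]

/-- A cubic polynomial with derivative `8 π³ ‖ξ‖²` in the direction `e`. -/
def cubicPhase (e : V) (ξ : V) : ℝ :=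
  8 * Real.pi ^ 3 * (‖ξ‖ ^ 2 * inner ℝ ξ e - 2 / 3 * inner ℝ ξ e ^ 3)

theorem hasTemperateGrowth_cubicPhase (e : V) : (cubicPhase e).HasTemperateGrowth := by
  have h1 : (fun ξ : V => (inner ℝ ξ e : ℝ)).HasTemperateGrowth :=
    Function.hasTemperateGrowth_inner_left e
  have h2 : (fun ξ : V => ‖ξ‖ ^ 2).HasTemperateGrowth := Function.hasTemperateGrowth_norm_sq V
  exact (Function.HasTemperateGrowth.const _).mul
    ((h2.mul h1).sub ((Function.HasTemperateGrowth.const _).mul (h1.pow 3)))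

theorem hasFDerivAt_cubicPhase (e : V) (ξ : V) :
    HasFDerivAt (cubicPhase e)
      ((8 * Real.pi ^ 3) • ((‖ξ‖ ^ 2 • (innerSL ℝ).flip e + (inner ℝ ξ e : ℝ) • (2 • innerSL ℝ ξ))
        - (2 / 3 : ℝ) • ((3 * inner ℝ ξ e ^ 2 : ℝ) • (innerSL ℝ).flip e))) ξ := by
  have h1 : HasFDerivAt (fun ξ : V => (inner ℝ ξ e : ℝ)) ((innerSL ℝ).flip e) ξ :=
    ((innerSL ℝ).flip e).hasFDerivAt
  have h2 : HasFDerivAt (fun ξ : V => ‖ξ‖ ^ 2) (2 • innerSL ℝ ξ) ξ :=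
    (hasStrictFDerivAt_norm_sq ξ).hasFDerivAt
  have h3 : HasFDerivAt (fun ξ : V => (inner ℝ ξ e : ℝ) ^ 3)
      ((3 * inner ℝ ξ e ^ 2 : ℝ) • (innerSL ℝ).flip e) ξ := by
    refine ((hasDerivAt_pow 3 (inner ℝ ξ e : ℝ)).comp_hasFDerivAt ξ h1).congr_fderiv ?_
    norm_num
  exact ((h2.fun_mul h1).sub (h3.const_mul _)).const_mul _

/-- Since ‖e‖ = 1, the 2⟪ξ, e⟫² coming from ‖ξ‖² cancels against the derivative of the cube, leaving
8π³‖ξ‖². -/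
theorem lineDerivOp_mulExpI_cubicPhase {e : V} (he : ‖e‖ = 1) (g : 𝓢(V, ℂ)) :
    ∂_{e} (mulExpI (fun ξ => -cubicPhase e ξ) g) =
      mulExpI (fun ξ => -cubicPhase e ξ) (∂_{e} g) -
        (8 * Real.pi ^ 3 * Complex.I) • mulNormSq (mulExpI (fun ξ => -cubicPhase e ξ) g) := by
  have hp : (fun ξ => -cubicPhase e ξ).HasTemperateGrowth := (hasTemperateGrowth_cubicPhase e).neg
  ext ξ
  rw [_root_.sub_apply, _root_.smul_apply, mulNormSq_apply, mulExpI_apply hp, mulExpI_apply hp,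
    lineDerivOp_apply_eq_fderiv, lineDerivOp_apply_eq_fderiv]
  have hfun : ⇑(mulExpI (fun ξ => -cubicPhase e ξ) g) = fun ξ =>
      Complex.exp (Complex.I * ((-cubicPhase e ξ : ℝ) : ℂ)) * g ξ := by
    ext ξ
    exact mulExpI_apply hp g ξ
  have h1 := ((Complex.ofRealCLM.hasFDerivAt.comp ξ
    (hasFDerivAt_cubicPhase e ξ).fun_neg).const_mul Complex.I).cexp
  have h2 := h1.mul (g.hasFDerivAt ξ)
  rw [hfun]
  erw [h2.fderiv]
  simp only [_root_.smul_apply, _root_.add_apply, ContinuousLinearMap.comp_apply,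
    _root_.sub_apply, _root_.neg_apply, ContinuousLinearMap.flip_apply, innerSL_apply_apply,
    Complex.ofRealCLM_apply, smul_eq_mul, real_inner_self_eq_norm_sq, he, nsmul_eq_mul,
    Function.comp_apply, Nat.cast_ofNat]
  push_cast
  ring

variable [FiniteDimensional ℝ V] [MeasurableSpace V] [BorelSpace V]

/-- The unitary map conjugating `Δ + ⟪x, e⟫` to multiplication by `⟪x, e⟫`. -/
def conj (p : V → ℝ) (φ : 𝓢(V, ℂ)) : 𝓢(V, ℂ) :=
  𝓕⁻ (mulExpI p (𝓕 φ))

theorem conj_neg_conj {p : V → ℝ} (hp : p.HasTemperateGrowth) (φ : 𝓢(V, ℂ)) :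
    conj (fun ξ => -p ξ) (conj p φ) = φ := by
  have hn : (fun ξ => -p ξ).HasTemperateGrowth := hp.neg
  have h : mulExpI (fun ξ => -p ξ) (mulExpI p (𝓕 φ)) = 𝓕 φ := by
    ext ξ
    rw [mulExpI_apply hn, mulExpI_apply hp, ← mul_assoc, ← Complex.exp_add]
    simp
  rw [conj, conj, FourierTransform.fourier_fourierInv_eq, h, FourierTransform.fourierInv_fourier_eq]

/-- In momentum space H is the first-order operator (i/2π)∂_e - 4π²‖ξ‖². A unimodular factor whose
phase has the right e-derivative gauges the quadratic term away. -/
theorem stark_conj {e : V} (he : ‖e‖ = 1) (ψ : 𝓢(V, ℂ)) :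
    Δ (conj (fun ξ => -cubicPhase e ξ) ψ) + mulCoord e (conj (fun ξ => -cubicPhase e ξ) ψ) =
      conj (fun ξ => -cubicPhase e ξ) (mulCoord e ψ) := by
  have hpi : (Real.pi : ℂ) ≠ 0 := by exact_mod_cast Real.pi_ne_zero
  have hinj : Function.Injective (𝓕 : 𝓢(V, ℂ) → 𝓢(V, ℂ)) :=
    Function.LeftInverse.injective (g := 𝓕⁻) FourierTransform.fourierInv_fourier_eq
  have h2pi : (2 * Real.pi * Complex.I : ℂ) ≠ 0 := by simp [hpi]
  apply hinj
  refine smul_right_injective _ h2pi ?_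
  simp only
  have h1 := fourier_mulCoord e (conj (fun ξ => -cubicPhase e ξ) ψ)
  have h2 := fourier_mulCoord e ψ
  have h3 : 𝓕 (conj (fun ξ => -cubicPhase e ξ) ψ) = mulExpI (fun ξ => -cubicPhase e ξ) (𝓕 ψ) :=
    FourierTransform.fourier_fourierInv_eq _
  have h4 : 𝓕 (conj (fun ξ => -cubicPhase e ξ) (mulCoord e ψ)) =
      mulExpI (fun ξ => -cubicPhase e ξ) (𝓕 (mulCoord e ψ)) :=
    FourierTransform.fourier_fourierInv_eq _
  rw [FourierTransform.fourier_add, smul_add, h1, fourier_laplacian, h3, h4,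
    ← map_smul (mulExpI fun ξ => -cubicPhase e ξ), h2, lineDerivOp_mulExpI_cubicPhase he, map_neg,
    smul_smul]
  have h5 : (2 * Real.pi * Complex.I * -(4 * Real.pi ^ 2) : ℂ) = -(8 * Real.pi ^ 3 * Complex.I) := by
    ring
  rw [h5]
  module

/-- Translation in energy by conjugation: the Stark evolution on Schwartz functions. -/
def starkShift (e : V) (s : ℝ) (φ : 𝓢(V, ℂ)) : 𝓢(V, ℂ) :=
  conj (fun ξ => -cubicPhase e ξ) (mulExpI (fun x => -s * inner ℝ x e) (conj (cubicPhase e) φ))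

theorem conj_add (p : V → ℝ) (φ ψ : 𝓢(V, ℂ)) : conj p (φ + ψ) = conj p φ + conj p ψ := by
  rw [conj, FourierTransform.fourier_add, map_add, FourierTransform.fourierInv_add]
  rfl

theorem conj_smul (p : V → ℝ) (c : ℂ) (φ : 𝓢(V, ℂ)) : conj p (c • φ) = c • conj p φ := by
  rw [conj, FourierTransform.fourier_smul, map_smul, FourierTransform.fourierInv_smul]
  rfl

/-- In the conjugated picture W annihilates every multiple of ⟪x, e⟫ + E. The difference e^{-is⟪x,
e⟫} - e^{isE} is such a multiple, with quotient of temperate growth, so neither continuity of W nor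
differentiation in s is needed. -/
theorem apply_starkShift {e : V} (he : ‖e‖ = 1) {E : ℝ} {W : 𝓢(V, ℂ) →ₗ[ℂ] ℂ}
    (hW : ∀ φ, W (Δ φ + mulCoord e φ) + E * W φ = 0) (s : ℝ) (φ : 𝓢(V, ℂ)) :
    W (starkShift e s φ) = Complex.exp (Complex.I * s * E) * W φ := by
  set ψ := conj (cubicPhase e) φ with hψ
  have hφ : conj (fun ξ => -cubicPhase e ξ) ψ = φ :=
    conj_neg_conj (hasTemperateGrowth_cubicPhase e) φ
  have hs : (fun x : V => -s * inner ℝ x e).HasTemperateGrowth :=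
    (Function.HasTemperateGrowth.const _).mul (Function.hasTemperateGrowth_inner_left e)
  have hz : (fun x : V => -s * (inner ℝ x e + E)).HasTemperateGrowth :=
    (Function.HasTemperateGrowth.const _).mul
      ((Function.hasTemperateGrowth_inner_left e).add (Function.HasTemperateGrowth.const _))
  have hd : (fun x : V => expDividedDiff 0 (-s * (inner ℝ x e + E))).HasTemperateGrowth :=
    hasTemperateGrowth_expDividedDiff.comp hz
  obtain ⟨g, hsplit⟩ : ∃ g : 𝓢(V, ℂ), mulExpI (fun x => -s * inner ℝ x e) ψ =
      Complex.exp (Complex.I * s * E) • ψ + (mulCoord e g + (E : ℂ) • g) := by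
    refine ⟨(-(Complex.I * s) * Complex.exp (Complex.I * s * E)) •
      SchwartzMap.smulLeftCLM ℂ (fun x : V => expDividedDiff 0 (-s * (inner ℝ x e + E))) ψ, ?_⟩
    ext x
    rw [_root_.add_apply, _root_.add_apply, _root_.smul_apply, _root_.smul_apply, mulCoord_apply,
      _root_.smul_apply, smulLeftCLM_apply_apply hd, mulExpI_apply hs]
    have h1 := mul_expDividedDiff (-s * (inner ℝ x e + E))
    have h2 : Complex.exp (Complex.I * ((-s * inner ℝ x e : ℝ) : ℂ)) =
        Complex.exp (Complex.I * s * E) *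
          Complex.exp (Complex.I * ((-s * (inner ℝ x e + E) : ℝ) : ℂ)) := by
      rw [← Complex.exp_add]
      congr 1
      push_cast
      ring
    rw [h2]
    simp only [smul_eq_mul]
    push_cast at h1 ⊢
    linear_combination (-Complex.exp (Complex.I * s * E) * ψ x) * h1
  rw [starkShift, hsplit, conj_add, conj_add, conj_smul, conj_smul, hφ, map_add, map_add,
    map_smul, map_smul, ← stark_conj he, smul_eq_mul, smul_eq_mul, hW, add_zero]

end Conjugation

/-! ### Functions of the energy with vanishing transform -/

section Energy

open FourierTransform

theorem one_add_abs_pow_le (N : ℕ) (u : ℝ) : (1 + |u|) ^ N ≤ 2 ^ (N - 1) * (1 + ‖u‖ ^ N) := by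
  have := add_pow_le (zero_le_one' ℝ) (abs_nonneg u) N
  simpa using this

theorem integrable_one_add_abs_pow_mul (χ : 𝓢(ℝ, ℂ)) (N : ℕ) :
    Integrable fun u : ℝ => (1 + |u|) ^ N * ‖χ u‖ := by
  have h := ((χ.integrable (μ := volume)).norm.add
    (χ.integrable_pow_mul volume N)).const_mul (2 ^ (N - 1))
  refine h.mono' (Continuous.aestronglyMeasurable (by fun_prop)) (ae_of_all _ fun u => ?_)
  rw [Real.norm_eq_abs, abs_of_nonneg (by positivity)]
  refine (mul_le_mul_of_nonneg_right (one_add_abs_pow_le N u) (norm_nonneg _)).trans (le_of_eq ?_)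
  simp only [Pi.add_apply]
  ring

/-- The constant 7 accommodates the scale 2πε for ε ≤ 1, and 1 + |E₀| + 7|u| ≤ (8 + |E₀|)(1 + |u|).
-/
theorem norm_le_of_growth {f : ℝ → ℂ} {C : ℝ} {N : ℕ} (hf : ∀ E, ‖f E‖ ≤ C * (1 + |E|) ^ N)
    (E₀ : ℝ) {δ : ℝ} (hδ : |δ| ≤ 7) (u : ℝ) :
    ‖f (E₀ + δ * u)‖ ≤ C * (8 + |E₀|) ^ N * (1 + |u|) ^ N := by
  have hC : 0 ≤ C := by
    have := (norm_nonneg _).trans (hf 0)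
    simpa using this
  refine (hf _).trans ?_
  rw [mul_assoc, ← mul_pow]
  refine mul_le_mul_of_nonneg_left (pow_le_pow_left₀ (by positivity) ?_ N) hC
  have h1 := abs_add_le E₀ (δ * u)
  rw [abs_mul] at h1
  nlinarith [abs_nonneg E₀, abs_nonneg u, mul_le_mul_of_nonneg_right hδ (abs_nonneg u),
    mul_nonneg (abs_nonneg E₀) (abs_nonneg u)]

theorem integrable_growth_mul {f : ℝ → ℂ} (hc : Continuous f) {C : ℝ} {N : ℕ}
    (hf : ∀ E, ‖f E‖ ≤ C * (1 + |E|) ^ N) (χ : 𝓢(ℝ, ℂ)) :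
    Integrable fun E : ℝ => f E * ∫ t : ℝ, χ t * Complex.exp (-(Complex.I * (E : ℂ) * (t : ℂ))) := by
  simp only [integral_energyPhase_eq_fourier]
  have h : Integrable fun u : ℝ => f (0 + 2 * Real.pi * u) * 𝓕 χ u := by
    refine ((integrable_one_add_abs_pow_mul (𝓕 χ) N).const_mul (C * (8 + |0|) ^ N)).mono'
      (Continuous.aestronglyMeasurable (by fun_prop)) (ae_of_all _ fun u => ?_)
    rw [norm_mul, ← mul_assoc]
    refine mul_le_mul_of_nonneg_right (norm_le_of_growth hf 0 ?_ u) (norm_nonneg _)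
    rw [abs_of_pos (by positivity)]
    linarith [Real.pi_lt_d2]
  have h2 := h.comp_div (show (2 * Real.pi) ≠ 0 by positivity)
  refine h2.congr (ae_of_all _ fun E => ?_)
  have : 0 + 2 * Real.pi * (E / (2 * Real.pi)) = E := by
    field_simp
    ring
  simp only [this]

/-- The test functions e^{iE₀t} ρ(εt), with ρ a bump and ρ(0) = 1, have transforms that form an
approximate identity at E₀ up to a constant factor. Continuity and polynomial growth let ε → 0. -/
theorem eq_zero_of_forall_integral_eq_zero {f : ℝ → ℂ} (hc : Continuous f) {C : ℝ} {N : ℕ}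
    (hf : ∀ E, ‖f E‖ ≤ C * (1 + |E|) ^ N)
    (h : ∀ χ : 𝓢(ℝ, ℂ), HasCompactSupport χ →
      ∫ E : ℝ, f E * ∫ t : ℝ, χ t * Complex.exp (-(Complex.I * (E : ℂ) * (t : ℂ))) = 0)
    (E₀ : ℝ) : f E₀ = 0 := by
  let b : ContDiffBump (0 : ℝ) := ⟨1, 2, one_pos, one_lt_two⟩
  have hρs : HasCompactSupport fun t : ℝ => ((b t : ℝ) : ℂ) :=
    b.hasCompactSupport.comp_left Complex.ofReal_zero
  have hρc : ContDiff ℝ ((⊤ : ℕ∞) : WithTop ℕ∞) fun t : ℝ => ((b t : ℝ) : ℂ) :=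
    Complex.ofRealCLM.contDiff.comp b.contDiff
  set ρ : 𝓢(ℝ, ℂ) := hρs.toSchwartzMap hρc with hρ
  have hρ0 : ρ 0 = 1 := by
    change ((b 0 : ℝ) : ℂ) = 1
    rw [b.one_of_mem_closedBall (by simp [b.rIn_pos.le])]
    simp
  have hzero : ∀ ε : ℝ, 0 < ε → ∫ u : ℝ, f (E₀ + 2 * Real.pi * ε * u) * 𝓕 ρ u = 0 := by
    intro ε hε
    have hs : HasCompactSupport fun t : ℝ =>
        Complex.exp (Complex.I * E₀ * t) * ((b (ε * t) : ℝ) : ℂ) :=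
      HasCompactSupport.mul_left (hρs.comp_homeomorph (Homeomorph.mulLeft₀ ε hε.ne'))
    have hcd : ContDiff ℝ ((⊤ : ℕ∞) : WithTop ℕ∞) fun t : ℝ =>
        Complex.exp (Complex.I * E₀ * t) * ((b (ε * t) : ℝ) : ℂ) := by
      have h1 : ContDiff ℝ ((⊤ : ℕ∞) : WithTop ℕ∞) fun t : ℝ => (t : ℂ) :=
        Complex.ofRealCLM.contDiff
      have h2 : ContDiff ℝ ((⊤ : ℕ∞) : WithTop ℕ∞) fun t : ℝ => ((b (ε * t) : ℝ) : ℂ) :=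
        hρc.comp (contDiff_const.mul contDiff_id)
      exact (contDiff_const.mul h1).cexp.mul h2
    have h1 := h (hs.toSchwartzMap hcd) hs
    have h2 : ∀ E : ℝ, ∫ t : ℝ, hs.toSchwartzMap hcd t *
        Complex.exp (-(Complex.I * (E : ℂ) * (t : ℂ))) =
        (ε⁻¹ : ℝ) * 𝓕 ρ ((E - E₀) / (2 * Real.pi * ε)) := by
      intro E
      have h3 := Measure.integral_comp_mul_left (fun t : ℝ =>
        ρ t * Complex.exp (-(Complex.I * ((E - E₀) / ε : ℝ) * (t : ℂ)))) ε
      rw [integral_energyPhase_eq_fourier, abs_of_pos (by positivity), Complex.real_smul,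
        div_div, mul_comm ε] at h3
      rw [← h3]
      congr 1 with t
      change Complex.exp (Complex.I * E₀ * t) * ((b (ε * t) : ℝ) : ℂ) * _ =
        ((b (ε * t) : ℝ) : ℂ) * _
      rw [mul_right_comm, ← Complex.exp_add, mul_comm]
      congr 2
      have hε' : (ε : ℂ) ≠ 0 := by exact_mod_cast hε.ne'
      push_cast
      field_simp
      ring
    simp only [h2] at h1
    have h4 := Measure.integral_comp_div (fun u : ℝ =>
      f (E₀ + 2 * Real.pi * ε * u) * ((ε⁻¹ : ℝ) * 𝓕 ρ u)) (2 * Real.pi * ε)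
    have h5 := integral_sub_right_eq_self (fun E : ℝ =>
      f (E₀ + 2 * Real.pi * ε * (E / (2 * Real.pi * ε))) *
        ((ε⁻¹ : ℝ) * 𝓕 ρ (E / (2 * Real.pi * ε)))) E₀ (μ := volume)
    have h6 : ∀ E : ℝ, E₀ + 2 * Real.pi * ε * ((E - E₀) / (2 * Real.pi * ε)) = E := by
      intro E
      have := Real.pi_ne_zero
      field_simp
      ring
    simp only [h6] at h5
    rw [h1, h4] at h5
    simp only [mul_left_comm _ ((ε⁻¹ : ℝ) : ℂ)] at h5
    rw [integral_const_mul] at h5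
    have h7 : ((ε⁻¹ : ℝ) : ℂ) ≠ 0 := by simpa using hε.ne'
    have h8 : |2 * Real.pi * ε| ≠ 0 := by positivity
    simpa [h8, hε.ne', Real.pi_ne_zero] using h5.symm
  have hlim : Tendsto (fun ε : ℝ => ∫ u : ℝ, f (E₀ + 2 * Real.pi * ε * u) * 𝓕 ρ u) (𝓝[>] 0)
      (𝓝 (∫ u : ℝ, f E₀ * 𝓕 ρ u)) := by
    refine tendsto_integral_filter_of_dominated_convergence
      (fun u => C * (8 + |E₀|) ^ N * ((1 + |u|) ^ N * ‖𝓕 ρ u‖))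
      (Eventually.of_forall fun ε => Continuous.aestronglyMeasurable (by fun_prop)) ?_
      ((integrable_one_add_abs_pow_mul (𝓕 ρ) N).const_mul _) (ae_of_all _ fun u => ?_)
    · filter_upwards [Ioo_mem_nhdsGT (zero_lt_one' ℝ)] with ε hε
      refine ae_of_all _ fun u => ?_
      rw [norm_mul, ← mul_assoc]
      refine mul_le_mul_of_nonneg_right (norm_le_of_growth hf E₀ ?_ u) (norm_nonneg _)
      have := hε.1
      rw [abs_of_pos (by positivity)]
      nlinarith [Real.pi_lt_d2, Real.pi_pos, hε.1, hε.2]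
    · have hcu : Continuous fun ε : ℝ => f (E₀ + 2 * Real.pi * ε * u) * 𝓕 ρ u := by fun_prop
      have := (hcu.tendsto 0).mono_left (nhdsWithin_le_nhds (s := Set.Ioi 0))
      simpa using this
  have hint : ∫ u : ℝ, 𝓕 ρ u = 1 := by
    have h1 : 𝓕⁻ (𝓕 ρ) = ρ := FourierTransform.fourierInv_fourier_eq ρ
    rw [← hρ0]
    conv_rhs => rw [← h1, SchwartzMap.fourierInv_coe, Real.fourierInv_eq']
    simp
  rw [integral_const_mul, hint, mul_one] at hlim
  refine tendsto_nhds_unique hlim (tendsto_const_nhds.congr' ?_)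
  filter_upwards [eventually_mem_nhdsWithin] with ε hε
  exact (hzero ε hε).symm

end Energy

/-! ### Uniqueness and the main theorem -/

section Main

open Laplacian

variable {n : ℕ} [NeZero n]

theorem gravityOp_apply_eq (E : ℝ) (T : 𝓢'(EuclideanSpace ℝ (Fin n), ℂ))
    (φ : 𝓢(EuclideanSpace ℝ (Fin n), ℂ)) :
    gravityOp E T φ = T (Δ φ + mulCoord (vertDir n) φ) + E * T φ := by
  have h : SchwartzMap.smulLeftCLM ℂ
      (fun x : EuclideanSpace ℝ (Fin n) => ((E + vert x : ℝ) : ℂ)) φ =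
      mulCoord (vertDir n) φ + (E : ℂ) • φ := by
    ext x
    rw [smulLeftCLM_apply_apply (potential_hasTemperateGrowth E), _root_.add_apply,
      _root_.smul_apply, mulCoord_apply, inner_vertDir, smul_eq_mul, smul_eq_mul]
    push_cast
    ring
  rw [gravityOp_apply, h, ← add_assoc, map_add, map_smul, smul_eq_mul]

theorem isCausalFundamentalSolution_causalSolution (y : EuclideanSpace ℝ (Fin n)) :
    IsCausalFundamentalSolution y (causalSolution y (norm_vertDir (n := n))) where
  fundamental E := by
    ext φ
    have h := causalPairing_stark y norm_vertDir E φ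
    rw [TemperedDistribution.delta_apply, _root_.neg_apply, gravityOp_apply_eq,
      causalSolution_apply, causalSolution_apply, h, neg_neg]
  continuous_energy φ := continuous_causalPairing y norm_vertDir φ
  growth_energy φ := ⟨2 * decayBound y (vertDir n) (FourierTransform.fourier φ) *
      ∫ t in Set.Ioi (0 : ℝ), (1 + t ^ 2)⁻¹, 0, fun E => by
    rw [pow_zero, mul_one]
    exact norm_causalPairing_le y norm_vertDir E φ⟩
  causal φ χ hχ := timeTransform_causalPairing y norm_vertDir φ hχ

/-- A causal family of solutions of the homogeneous equation vanishes. -/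
theorem eq_zero_of_homogeneous {V : Type*} [NormedAddCommGroup V] [InnerProductSpace ℝ V]
    [FiniteDimensional ℝ V] [MeasurableSpace V] [BorelSpace V] {e : V} (he : ‖e‖ = 1)
    {W : ℝ → 𝓢(V, ℂ) →ₗ[ℂ] ℂ}
    (hW : ∀ E φ, W E (Δ φ + mulCoord e φ) + E * W E φ = 0)
    (hc : ∀ φ, Continuous fun E => W E φ)
    (hg : ∀ φ, ∃ (C : ℝ) (N : ℕ), ∀ E : ℝ, ‖W E φ‖ ≤ C * (1 + |E|) ^ N)
    (hcausal : ∀ (φ : 𝓢(V, ℂ)) (χ : 𝓢(ℝ, ℂ)), tsupport χ ⊆ Set.Iio 0 →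
      ∫ E : ℝ, W E φ * ∫ t : ℝ, χ t * Complex.exp (-(Complex.I * (E : ℂ) * (t : ℂ))) = 0)
    (E : ℝ) (φ : 𝓢(V, ℂ)) : W E φ = 0 := by
  obtain ⟨C, N, hCN⟩ := hg φ
  refine eq_zero_of_forall_integral_eq_zero (hc φ) hCN (fun χ hχ => ?_) E
  obtain ⟨a, ha⟩ := hχ.isCompact.bddAbove
  have hshift : ∀ t, compSubConstCLM ℂ (-(a + 1)) χ t = χ (t + (a + 1)) := by
    intro t
    rw [compSubConstCLM_apply, sub_neg_eq_add]
  have hsupp : tsupport (compSubConstCLM ℂ (-(a + 1)) χ) ⊆ Set.Iio 0 := by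
    -- The extra 1 in the shift places the support in the closed half-line t ≤ -1, so that its
    -- closure still lies in t < 0.
    refine (closure_minimal (t := Set.Iic (-1)) (fun t ht => ?_) isClosed_Iic).trans fun t ht => ?_
    · rw [Function.mem_support, hshift] at ht
      have := ha (subset_tsupport _ ht)
      rw [Set.mem_Iic]
      linarith
    · rw [Set.mem_Iic] at ht
      rw [Set.mem_Iio]
      linarith
  -- Evolving φ multiplies W by e^{-i(a+1)E}, and translating χ multiplies its transform by the
  -- inverse phase. The integral for the original φ and χ is therefore unchanged.
  have h := hcausal (starkShift e (-(a + 1)) φ) _ hsupp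
  rw [← h]
  congr 1 with E
  rw [apply_starkShift he (hW E), mul_right_comm]
  have h1 : ∫ t : ℝ, compSubConstCLM ℂ (-(a + 1)) χ t *
        Complex.exp (-(Complex.I * (E : ℂ) * (t : ℂ))) =
      Complex.exp (-(Complex.I * ((-(a + 1) : ℝ) : ℂ) * E)) *
        ∫ t : ℝ, χ t * Complex.exp (-(Complex.I * (E : ℂ) * (t : ℂ))) := by
    rw [← integral_const_mul, ← integral_add_right_eq_self (fun t : ℝ =>
      Complex.exp (-(Complex.I * ((-(a + 1) : ℝ) : ℂ) * E)) *
        (χ t * Complex.exp (-(Complex.I * (E : ℂ) * (t : ℂ))))) (a + 1)]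
    congr 1 with t
    rw [hshift, mul_left_comm, ← Complex.exp_add]
    congr 2
    push_cast
    ring
  rw [h1, ← mul_assoc, ← Complex.exp_add, add_neg_cancel, Complex.exp_zero, one_mul, mul_comm]

theorem IsCausalFundamentalSolution.unique {y : EuclideanSpace ℝ (Fin n)}
    {U V : ℝ → 𝓢'(EuclideanSpace ℝ (Fin n), ℂ)} (hU : IsCausalFundamentalSolution y U)
    (hV : IsCausalFundamentalSolution y V) : V = U := by
  have hgrowth : ∀ φ : 𝓢(EuclideanSpace ℝ (Fin n), ℂ), ∃ (C : ℝ) (N : ℕ), ∀ E : ℝ,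
      ‖V E φ - U E φ‖ ≤ C * (1 + |E|) ^ N := by
    intro φ
    obtain ⟨C₁, N₁, h₁⟩ := hU.growth_energy φ
    obtain ⟨C₂, N₂, h₂⟩ := hV.growth_energy φ
    have hpow : ∀ {C : ℝ} {N M : ℕ} (z : ℝ), 0 ≤ C → N ≤ M →
        C * (1 + |z|) ^ N ≤ C * (1 + |z|) ^ M := fun z hC hNM =>
      mul_le_mul_of_nonneg_left (pow_le_pow_right₀ (by linarith [abs_nonneg z]) hNM) hC
    have hnonneg : ∀ {f : ℝ → ℂ} {C : ℝ} {N : ℕ}, (∀ E, ‖f E‖ ≤ C * (1 + |E|) ^ N) → 0 ≤ C := by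
      intro f C N hf
      have := (norm_nonneg _).trans (hf 0)
      simpa using this
    refine ⟨C₂ + C₁, max N₂ N₁, fun E => (norm_sub_le _ _).trans ?_⟩
    rw [add_mul]
    exact add_le_add ((h₂ E).trans (hpow E (hnonneg h₂) (le_max_left _ _)))
      ((h₁ E).trans (hpow E (hnonneg h₁) (le_max_right _ _)))
  have hzero : ∀ E φ, ((V E : 𝓢(EuclideanSpace ℝ (Fin n), ℂ) →ₗ[ℂ] ℂ) -
      (U E : 𝓢(EuclideanSpace ℝ (Fin n), ℂ) →ₗ[ℂ] ℂ)) φ = 0 := by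
    refine eq_zero_of_homogeneous (norm_vertDir (n := n)) (fun E φ => ?_)
      (fun φ => (hV.continuous_energy φ).sub (hU.continuous_energy φ)) hgrowth
      (fun φ χ hχ => ?_)
    · have h1 := congrArg (fun T => T φ) ((hU.fundamental E).trans (hV.fundamental E).symm)
      have h2 : gravityOp E (U E) φ = gravityOp E (V E) φ := neg_injective h1
      rw [gravityOp_apply_eq, gravityOp_apply_eq] at h2
      change (V E _ - U E _) + E * (V E φ - U E φ) = 0
      linear_combination -h2
    · obtain ⟨C₁, N₁, h₁⟩ := hU.growth_energy φ
      obtain ⟨C₂, N₂, h₂⟩ := hV.growth_energy φ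
      have hpi : (1 / (2 * (Real.pi : ℂ))) ≠ 0 := by
        simp [Real.pi_ne_zero]
      have h3 := (mul_eq_zero.1 (hU.causal φ χ hχ)).resolve_left hpi
      have h4 := (mul_eq_zero.1 (hV.causal φ χ hχ)).resolve_left hpi
      have h5 := integral_sub (integrable_growth_mul (hV.continuous_energy φ) h₂ χ)
        (integrable_growth_mul (hU.continuous_energy φ) h₁ χ)
      rw [h3, h4, sub_zero] at h5
      rw [← h5]
      congr 1 with E
      exact sub_mul _ _ _
  ext E φ
  exact sub_eq_zero.1 (hzero E φ)

end Main

end GravityHelmholtz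

end

theorem mainTheorem4 (n : ℕ) [NeZero n] (y : EuclideanSpace ℝ (Fin n)) :
    (∀ (E : ℝ) (x : EuclideanSpace ℝ (Fin n)), (x ≠ y ∨ n = 1) →
      GravityHelmholtz.HasOscillatoryIntegral (GravityHelmholtz.kernelIntegrand E x y)
        (GravityHelmholtz.oscillatoryIntegral (GravityHelmholtz.kernelIntegrand E x y)) ∧
      (n ≤ 3 →
        GravityHelmholtz.HasImproperIntegral (GravityHelmholtz.kernelIntegrand E x y)
          (GravityHelmholtz.oscillatoryIntegral (GravityHelmholtz.kernelIntegrand E x y)))) ∧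
    (∀ E : ℝ, ContinuousOn (fun x => GravityHelmholtz.kernel E x y)
      {x : EuclideanSpace ℝ (Fin n) | x ≠ y}) ∧
    (∃ U : ℝ → TemperedDistribution (EuclideanSpace ℝ (Fin n)) ℂ,
      GravityHelmholtz.IsCausalFundamentalSolution y U ∧
      (∀ V : ℝ → TemperedDistribution (EuclideanSpace ℝ (Fin n)) ℂ,
        GravityHelmholtz.IsCausalFundamentalSolution y V → V = U) ∧
      ∀ E : ℝ, GravityHelmholtz.IsRegularWith (U E) (fun x => GravityHelmholtz.kernel E x y)) := by
  have hU := GravityHelmholtz.isCausalFundamentalSolution_causalSolution y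
  refine ⟨fun E x hx => ?_, fun E => GravityHelmholtz.continuousOn_kernel E y,
    _, hU, fun V hV => hU.unique hV, fun E => ⟨GravityHelmholtz.locallyIntegrable_kernel E y,
      fun φ hφ => GravityHelmholtz.causalPairing_eq_integral_kernel E y hφ⟩⟩
  rw [GravityHelmholtz.oscillatoryIntegral_kernelIntegrand E hx]
  exact ⟨GravityHelmholtz.hasOscillatoryIntegral_kernelIntegrand E hx,
    fun hn => GravityHelmholtz.hasImproperIntegral_kernelIntegrand E hx hn⟩
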